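/- For $n\ge 2$ let $B_n$ be the braid group with generators $\sigma_1,\dots,\sigma_{n-1}$ and relations $\sigma_i\sigma_j=\sigma_j\sigma_i$ for $|i-j|\ge 2$, $\sigma_i\sigma_j\sigma_i=\sigma_j\sigma_i\sigma_j$ for $|i-j|=1$; let $B_n^+$ be the submonoid generated by the $\sigma_i$, and let $B_\infty$ be the group with the same presentation on $\sigma_1,\sigma_2,\dots$. As usual, $B_n$ is identified with its image in $B_{n+1}$ and in $B_\infty$ under $\sigma_i\mapsto\sigma_i$. For braids $b,b'$, write $b<b'$ if $b^{-1}b'$ is represented by a word in the letters $\sigma_i^{\pm1}$, $i\ge1$, such that, for the highest index $i$ occurring in the word, $\sigma_i$ occurs and $\sigma_i^{-1}$ does not. Let $\phi_n$ be the automorphism of $B_n$ with $\phi_n(\sigma_i)=\sigma_{n-i}$. For $n\ge3$ and $b\in B_{n-1}$ put $$\tilde\phi_n b=\sigma_1\sigma_2^2\cdots\sigma_{n-2}^2\sigma_{n-1}\cdot\phi_n b\cdot\sigma_{n-1}\sigma_{n-2}^2\cdots\sigma_2^2\sigma_1,$$ and let $\langle b_p,\dots,b_1\rangle_{n,p}=c_p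 c_{p-1}\cdots c_1$, where $c_k=\tilde\phi_n b_k$ for $k$ even and $c_k=b_k$ for $k$ odd; for $p=0$ this is the trivial braid $1$. The special $2$-braids are the elements of $B_2^+$; for $n\ge3$, the special $n$-braids are $1$ and the braids $\langle b_p,\dots,b_1\rangle_{n,p}$ with $p\ge1$, where $b_p,\dots,b_1$ are special $(n-1)$-braids and $b_p\ne1$. A sequence of braids $(b_p,\dots,b_1)$ is ShortLex-smaller than $(b'_q,\dots,b'_1)$ if either $p<q$, or $p=q$ and there is $r$ with $b_r<b'_r$ and $b_k=b'_k$ for all $k>r$. **Proposition 4.6.** Let $n\ge3$ and $p,q\ge 0$, and let $b=\langle b_p,\dots,b_1\rangle_{n,p}$ and $b'=\langle b'_q,\dots,b'_1\rangle_{n,q}$ be special $n$-braids, where all $b_k$ and $b'_k$ are special $(n-1)$-braids, $b_p\ne1$ if $p\ge1$, and $b'_q\ne1$ if $q\ge1$. Then $b<b'$ holds if and only if $(b_p,\dots,b_1)$ is ShortLex-smaller than $(b'_q,\dots,b'_1)$. -/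

import Mathlib

/-- The Artin relators on the generators `σ_i`, `i ∈ S`, for a set `S` of indices: far commutation
`σ_i σ_j = σ_j σ_i` for `|i - j| ≥ 2` and `σ_i σ_j σ_i = σ_j σ_i σ_j` for `|i - j| = 1`. -/
def artinRels (S : Set ℕ) : Set (FreeGroup S) :=
  {r | ∃ i j : S, 2 ≤ |((i : ℕ) : ℤ) - ((j : ℕ) : ℤ)| ∧
      r = FreeGroup.of i * FreeGroup.of j * (FreeGroup.of j * FreeGroup.of i)⁻¹} ∪
  {r | ∃ i j : S, |((i : ℕ) : ℤ) - ((j : ℕ) : ℤ)| = 1 ∧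
      r = FreeGroup.of i * FreeGroup.of j * FreeGroup.of i *
        (FreeGroup.of j * FreeGroup.of i * FreeGroup.of j)⁻¹}

/-- The group generated by the `σ_i`, `i ∈ S`, subject to the Artin relations. -/
abbrev ArtinBraid (S : Set ℕ) : Type := PresentedGroup (artinRels S)

/-- The `n`-strand braid group `B_n`, with generators `σ_1, …, σ_{n-1}`. -/
abbrev Braid (n : ℕ) : Type := ArtinBraid (Set.Ico 1 n)

/-- The group `B_∞`, with generators `σ_1, σ_2, …`. -/
abbrev BraidInf : Type := ArtinBraid (Set.Ici 1)

/-- A map of indices that preserves `|i - j|` is compatible with the Artin relations. -/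
theorem artinRels_lift_eq_one {S T : Set ℕ} (f : S → T)
    (hf : ∀ i j : S, |((f i : ℕ) : ℤ) - ((f j : ℕ) : ℤ)| = |((i : ℕ) : ℤ) - ((j : ℕ) : ℤ)|) :
    ∀ r ∈ artinRels S,
      FreeGroup.lift (fun i => (PresentedGroup.of (f i) : ArtinBraid T)) r = 1 := by
  have key : ∀ r ∈ artinRels S, FreeGroup.map f r ∈ artinRels T := by
    rintro r (⟨i, j, h, rfl⟩ | ⟨i, j, h, rfl⟩)
    · exact Or.inl ⟨f i, f j, by rw [hf]; exact h, by simp⟩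
    · exact Or.inr ⟨f i, f j, by rw [hf]; exact h, by simp⟩
  have hcomp : FreeGroup.lift (fun i => (PresentedGroup.of (f i) : ArtinBraid T)) =
      (PresentedGroup.mk (artinRels T)).comp (FreeGroup.map f) := by
    ext i
    simp [PresentedGroup.of]
  intro r hr
  rw [hcomp, MonoidHom.comp_apply]
  exact PresentedGroup.one_of_mem (key r hr)

/-- The homomorphism `σ_i ↦ σ_{f i}` for a map of indices `f` that preserves `|i - j|`. -/
def ArtinBraid.map {S T : Set ℕ} (f : S → T)
    (hf : ∀ i j : S, |((f i : ℕ) : ℤ) - ((f j : ℕ) : ℤ)| = |((i : ℕ) : ℤ) - ((j : ℕ) : ℤ)|) :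
    ArtinBraid S →* ArtinBraid T :=
  PresentedGroup.toGroup (artinRels_lift_eq_one f hf)

namespace Braid

/-- The generator `σ_i` of `B_n`, for `1 ≤ i ≤ n - 1` (and `1` for other `i`, which never occur
below). -/
def σ (n i : ℕ) : Braid n :=
  if h : 1 ≤ i ∧ i < n then PresentedGroup.of ⟨i, h⟩ else 1

/-- The monoid `B_n^+` of positive `n`-braids, as a submonoid of `B_n`. -/
def positive (n : ℕ) : Submonoid (Braid n) :=
  Submonoid.closure (Set.range (PresentedGroup.of : Set.Ico 1 n → Braid n))

/-- The canonical homomorphism `B_{n-1} → B_n`, `σ_i ↦ σ_i`. -/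
def incl (n : ℕ) : Braid (n - 1) →* Braid n :=
  ArtinBraid.map (fun i => ⟨i.1, i.2.1, by have := i.2.2; omega⟩) (fun _ _ => rfl)

/-- The canonical homomorphism `B_n → B_∞`, `σ_i ↦ σ_i`. -/
def toInf (n : ℕ) : Braid n →* BraidInf :=
  ArtinBraid.map (fun i => ⟨i.1, i.2.1⟩) (fun _ _ => rfl)

/-- The flip `φ_n` of `B_n`, `σ_i ↦ σ_{n-i}`. -/
def flip (n : ℕ) : Braid n →* Braid n :=
  ArtinBraid.map
    (fun i => ⟨n - i.1, by have h1 := i.2.1; have h2 := i.2.2; constructor <;> omega⟩)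
    (fun i j => by
      have hi := i.2.2
      have hj := j.2.2
      simp only
      rw [Nat.cast_sub hi.le, Nat.cast_sub hj.le, abs_sub_comm]
      congr 1
      ring)

/-- The separated flip, for `n ≥ 3`: for `b ∈ B_{n-1}`, the braid
`σ_1 σ_2² ⋯ σ_{n-2}² σ_{n-1} · φ_n b · σ_{n-1} σ_{n-2}² ⋯ σ_2² σ_1`. -/
def sepFlip (n : ℕ) (b : Braid (n - 1)) : Braid n :=
  (σ n 1 * ((List.range' 2 (n - 3)).map (fun i => σ n i ^ 2)).prod * σ n (n - 1)) *
    flip n (incl n b) *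
    (σ n (n - 1) * ((List.range' 2 (n - 3)).reverse.map (fun i => σ n i ^ 2)).prod * σ n 1)

/-- The skew product `⟨b_p, …, b_1⟩_{n,p}` of the list `[b_p, …, b_1]`: the product from left to
right of the entries, where the entries `b_k` with `k` even (counted from the right, starting at
`1`) are replaced with their separated flips. In `b :: l`, the entry `b` has position
`l.length + 1`. -/
def skew (n : ℕ) : List (Braid (n - 1)) → Braid n
  | [] => 1
  | b :: l => (if Even (l.length + 1) then sepFlip n b else incl n b) * skew n l

/-- Special `n`-braids, for `n ≥ 2` (there are none for `n < 2`): every positive `2`-braid is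
special; for `n ≥ 3`, the special `n`-braids are `1` and the skew products `⟨b_p, …, b_1⟩_{n,p}`,
`p ≥ 1`, of special `(n-1)`-braids with `b_p ≠ 1`. -/
def IsSpecial : (n : ℕ) → Braid n → Prop
  | 0, _ => False
  | 1, _ => False
  | 2, b => b ∈ positive 2
  | n + 3, b => b = 1 ∨ ∃ (c : Braid (n + 2)) (l : List (Braid (n + 2))),
      c ≠ 1 ∧ IsSpecial (n + 2) c ∧ (∀ x ∈ l, IsSpecial (n + 2) x) ∧ b = skew (n + 3) (c :: l)

end Braid

/-- A braid word (a list of letters `(i, true)` for `σ_i` and `(i, false)` for `σ_i⁻¹`) is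
`σ`-positive if the generator of highest index that occurs in it occurs only positively. -/
def IsSigmaPositiveWord (w : List (Set.Ici 1 × Bool)) : Prop :=
  ∃ i : Set.Ici 1, (i, true) ∈ w ∧ (i, false) ∉ w ∧ ∀ x ∈ w, x.1 ≤ i

/-- The braid order on `B_∞`: `a < b` if `a⁻¹ b` is represented by a `σ`-positive word. -/
def BraidInf.Lt (a b : BraidInf) : Prop :=
  ∃ w : List (Set.Ici 1 × Bool), IsSigmaPositiveWord w ∧
    PresentedGroup.mk (artinRels (Set.Ici 1)) (FreeGroup.mk w) = a⁻¹ * b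

/-- The braid order on `B_n`, seen inside `B_∞`. -/
def Braid.Lt {n : ℕ} (a b : Braid n) : Prop :=
  BraidInf.Lt (Braid.toInf n a) (Braid.toInf n b)

/-!
The braids `x = ⟨b_p, …, b_1⟩` and `x' = ⟨b'_q, …, b'_1⟩` of `B_n` are compared by computing
`x⁻¹ x'` in `B_∞`, for which a form without separated flips is used. Since the flip is the
conjugation by Garside's half-turn `Δ_n`, and since `Δ_n = W u = ũ W` where `u` and `ũ` are the two
outer factors of the separated flip and `W` is a braid with a single letter `σ_{n-1}`, the separated
flip of `b` is `Δ_n² W⁻¹ b W⁻¹`. As `Δ_n²` is central in `B_n`, a skew product is a power of `Δ_n²`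
times `b_p W⁻¹ b_{p-1} W⁻¹ ⋯ W⁻¹ b_1`, with a further `W⁻¹` in front if `p` is even
(`Braid.toInf_skew`). So if `p = q` and the entries first differ in position `r`, then `x⁻¹ x'` is
`b_1⁻¹ W ⋯ b_{r-1}⁻¹ W · b_r⁻¹ b'_r · W⁻¹ b'_{r-1} ⋯ W⁻¹ b'_1`.

For three strands `W = σ_2`, and the relation `σ_2 σ_1^a σ_2⁻¹ = σ_1⁻¹ σ_2^a σ_1` with `a ≥ 1`,
starting at `W b_r⁻¹ b'_r W⁻¹` and repeated to the right, eliminates every `σ_2⁻¹`. In general the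
letters `σ_{n-1}⁻¹` are eliminated in the same way, and what has to be controlled is the braid of
`B_{n-1}` that stands after the last `σ_{n-1}`. The sets `BraidInf.G` are designed for this: their
elements are `σ_{n-1}`-positive, they absorb on the left all braids that have an expression without
`σ_{n-1}⁻¹`, and they are stable under right multiplication by `W⁻¹` (`BraidInf.inv_W_mem_R`) and by
positive braids of `B_{n-1}` (`BraidInf.positive_le_R`). The recursion
`W_{n+1} = W_n W_{n-1}⁻¹ σ_n W_n` shows that the conjugate of `x⁻¹ x'` by `W_{n+1}` is in the next
such set as soon as the conjugate by `W_n` is in the present one (`BraidInf.conj_W_succ`). Hence the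
relation `Braid.StrongLt`, stronger than the braid order, is carried from the entries of lists to
skew products (`Braid.strongLt_skew`), also when `p < q`, where the extra factors on the left end
with a reversed flip factor `ũ`, which lies in `G`, or with a single entry `≠ 1`.

By induction on the number of strands, special braids are therefore totally ordered by
`Braid.StrongLt`. Both directions of the equivalence follow from this once the braid order is known
to be irreflexive, that is, once a `σ`-positive word never represents `1`. This is proved by Larue's
argument: in Artin's action on a free group, a word in which `σ_i` is the highest generator and
`σ_i⁻¹` does not occur maps `x_{i+1}` to an element whose reduced word starts with `x_{i+1}⁻¹`
(`BraidInf.artinAction_word`).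
-/

/-! ### The generators of `B_∞` -/

namespace BraidInf

/-- The generator `σ_i` of `B_∞`, for `i ≥ 1`; the value `s 0 = 1` is a convention. -/
def s (i : ℕ) : BraidInf :=
  if h : 1 ≤ i then PresentedGroup.of ⟨i, h⟩ else 1

theorem s_zero : s 0 = 1 := rfl

theorem s_coe (i : Set.Ici 1) : s (i : ℕ) = PresentedGroup.of i := by
  have h : 1 ≤ (i : ℕ) := i.2
  simp [s, h]

theorem s_comm {i j : ℕ} (h : i + 2 ≤ j) : Commute (s i) (s j) := by
  rcases Nat.eq_zero_or_pos i with rfl | hi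
  · rw [s_zero]
    exact Commute.one_left _
  have hr := PresentedGroup.one_of_mem (rels := artinRels (Set.Ici 1))
    (Or.inl ⟨⟨i, hi⟩, ⟨j, show 1 ≤ j by omega⟩, by
      rw [abs_sub_comm, abs_of_nonneg] <;> simp only <;> omega, rfl⟩)
  rw [map_mul, map_inv, mul_inv_eq_one, map_mul, map_mul] at hr
  have h1 : s i = PresentedGroup.of ⟨i, hi⟩ := s_coe ⟨i, hi⟩
  have h2 : s j = PresentedGroup.of ⟨j, show 1 ≤ j by omega⟩ :=
    s_coe ⟨j, show 1 ≤ j by omega⟩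
  rw [Commute, SemiconjBy, h1, h2]
  exact hr

theorem s_braid {i : ℕ} (hi : 1 ≤ i) :
    s i * s (i + 1) * s i = s (i + 1) * s i * s (i + 1) := by
  have hr := PresentedGroup.one_of_mem (rels := artinRels (Set.Ici 1))
    (Or.inr ⟨⟨i, hi⟩, ⟨i + 1, show 1 ≤ i + 1 by omega⟩, by simp, rfl⟩)
  rw [map_mul, map_inv, mul_inv_eq_one, map_mul, map_mul, map_mul, map_mul] at hr
  have h1 : s i = PresentedGroup.of ⟨i, hi⟩ := s_coe ⟨i, hi⟩
  have h2 : s (i + 1) = PresentedGroup.of ⟨i + 1, show 1 ≤ i + 1 by omega⟩ :=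
    s_coe ⟨i + 1, show 1 ≤ i + 1 by omega⟩
  rw [h1, h2]
  exact hr

/-- The conjugation form of the braid relation by which `σ_{i+1}⁻¹` is eliminated. -/
theorem s_conj {i : ℕ} (hi : 1 ≤ i) :
    s (i + 1) * s i * (s (i + 1))⁻¹ = (s i)⁻¹ * s (i + 1) * s i := by
  rw [mul_inv_eq_iff_eq_mul, mul_assoc, mul_assoc, eq_inv_mul_iff_mul_eq, ← mul_assoc,
    ← mul_assoc]
  exact s_braid hi

theorem s_conj_pow {i : ℕ} (hi : 1 ≤ i) (a : ℕ) :
    s (i + 1) * s i ^ a * (s (i + 1))⁻¹ = (s i)⁻¹ * s (i + 1) ^ a * s i := by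
  have h := congrArg (· ^ a) (s_conj hi)
  simp only [conj_pow] at h
  have h2 := conj_pow (i := a) (a := (s i)⁻¹) (b := s (i + 1))
  rw [inv_inv] at h2
  rw [h, h2]

/-! ### Subgroups and monoids of braids -/

/-- The subgroup `B_k` of `B_∞`, generated by the `σ_i` with `i < k`. -/
def strands (k : ℕ) : Subgroup BraidInf :=
  Subgroup.closure {x | ∃ i < k, x = s i}

/-- The submonoid of `B_{k+1}` of the braids that have an expression without `σ_k⁻¹`. -/
def nonneg (k : ℕ) : Submonoid BraidInf :=
  Submonoid.closure (insert (s k) (strands k : Set BraidInf))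

/-- The submonoid `B_k⁺` of `B_∞`, generated by the `σ_i` with `i < k`. -/
def positive (k : ℕ) : Submonoid BraidInf :=
  Submonoid.closure {x | ∃ i < k, x = s i}

theorem s_mem_strands {i k : ℕ} (h : i < k) : s i ∈ strands k :=
  Subgroup.subset_closure ⟨i, h, rfl⟩

theorem strands_mono {k l : ℕ} (h : k ≤ l) : strands k ≤ strands l :=
  Subgroup.closure_mono fun _ ⟨i, hi, hx⟩ => ⟨i, hi.trans_le h, hx⟩

theorem strands_commute {k : ℕ} {g : BraidInf} (hg : g ∈ strands k) {l : ℕ} (h : k < l) :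
    Commute g (s l) := by
  induction hg using Subgroup.closure_induction with
  | mem x hx =>
    obtain ⟨i, hi, rfl⟩ := hx
    exact s_comm (by omega)
  | one => exact Commute.one_left _
  | mul x y _ _ hx hy => exact hx.mul_left hy
  | inv x _ hx => exact hx.inv_left

theorem s_mem_nonneg (k : ℕ) : s k ∈ nonneg k :=
  Submonoid.subset_closure (Set.mem_insert _ _)

theorem strands_le_nonneg {k : ℕ} {g : BraidInf} (hg : g ∈ strands k) : g ∈ nonneg k :=
  Submonoid.subset_closure (Set.mem_insert_of_mem _ hg)

theorem nonneg_le_strands {k : ℕ} {g : BraidInf} (hg : g ∈ nonneg k) : g ∈ strands (k + 1) := by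
  refine (Submonoid.closure_le (S := (strands (k + 1)).toSubmonoid)).2 ?_ hg
  rintro x (rfl | hx)
  · exact s_mem_strands (Nat.lt_succ_self k)
  · exact strands_mono (Nat.le_succ k) hx

theorem positive_mono {k l : ℕ} (h : k ≤ l) : positive k ≤ positive l :=
  Submonoid.closure_mono fun _ ⟨i, hi, hx⟩ => ⟨i, hi.trans_le h, hx⟩

theorem s_mem_positive {i k : ℕ} (h : i < k) : s i ∈ positive k :=
  Submonoid.subset_closure ⟨i, h, rfl⟩

theorem positive_le_nonneg {k : ℕ} {g : BraidInf} (hg : g ∈ positive (k + 1)) :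
    g ∈ nonneg k := by
  refine (Submonoid.closure_le (S := nonneg k)).2 ?_ hg
  rintro x ⟨i, hi, rfl⟩
  rcases Nat.lt_succ_iff_lt_or_eq.1 hi with h | rfl
  · exact strands_le_nonneg (s_mem_strands h)
  · exact s_mem_nonneg i

theorem positive_le_strands {k : ℕ} {g : BraidInf} (hg : g ∈ positive k) : g ∈ strands k :=
  (Submonoid.closure_le (S := (strands k).toSubmonoid)).2 Subgroup.subset_closure hg

theorem conj_mem_nonneg {k : ℕ} (hk : 1 ≤ k) {g : BraidInf} (hg : g ∈ nonneg k) :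
    s (k + 1) * g * (s (k + 1))⁻¹ ∈ nonneg (k + 1) := by
  have h : nonneg k ≤ (nonneg (k + 1)).comap (MulAut.conj (s (k + 1))).toMonoidHom := by
    refine Submonoid.closure_le.2 ?_
    rintro x (rfl | hx)
    · change s (k + 1) * s k * (s (k + 1))⁻¹ ∈ nonneg (k + 1)
      rw [s_conj hk]
      exact mul_mem (mul_mem (strands_le_nonneg (inv_mem (s_mem_strands (Nat.lt_succ_self k))))
        (s_mem_nonneg _)) (strands_le_nonneg (s_mem_strands (Nat.lt_succ_self k)))
    · change s (k + 1) * x * (s (k + 1))⁻¹ ∈ nonneg (k + 1)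
      rw [← (strands_commute hx (Nat.lt_succ_self k)).eq, mul_inv_cancel_right]
      exact strands_le_nonneg (strands_mono (Nat.le_succ k) hx)
  exact h hg

/-! ### The braids separating consecutive entries -/

/-- The braids `d j = σ_{j+2} σ_{j+1} ⋯ σ_3 σ_1⁻¹ σ_2`, the quotients of consecutive `W j`. -/
def d : ℕ → BraidInf
  | 0 => (s 1)⁻¹ * s 2
  | j + 1 => s (j + 3) * d j

/-- The braids `W j = Δ_{j+2} u⁻¹` of `B_{j+2}`, where `u = σ_1 σ_2² ⋯ σ_j² σ_{j+1}`
(and `u = 1` for `j = 0`). They separate the entries of a skew product of `B_{j+2}`. -/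
def W : ℕ → BraidInf
  | 0 => s 1
  | j + 1 => W j * d j

theorem d_succ (j : ℕ) : d (j + 1) = s (j + 3) * d j := rfl

theorem W_succ (j : ℕ) : W (j + 1) = W j * d j := rfl

theorem W_one : W 1 = s 2 := by
  simp [W, d]

theorem d_mem (j : ℕ) : d j ∈ strands (j + 3) := by
  induction j with
  | zero => exact mul_mem (inv_mem (s_mem_strands (by omega))) (s_mem_strands (by omega))
  | succ j ih => exact mul_mem (s_mem_strands (by omega)) (strands_mono (by omega) ih)

theorem W_mem (j : ℕ) : W j ∈ strands (j + 2) := by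
  induction j with
  | zero => exact s_mem_strands (by omega)
  | succ j ih => exact mul_mem (strands_mono (by omega) ih) (d_mem j)

theorem W_mul_s_comm (j : ℕ) : Commute (W j) (s (j + 3)) :=
  strands_commute (W_mem j) (by omega)

theorem W_add_two (j : ℕ) : W (j + 2) = W (j + 1) * (W j)⁻¹ * s (j + 3) * W (j + 1) := by
  rw [W_succ (j + 1), d_succ, mul_assoc (W (j + 1)) (W j)⁻¹,
    (W_mul_s_comm j).inv_left.eq, W_succ j]
  group

theorem W_succ_mem_nonneg (j : ℕ) : W (j + 1) ∈ nonneg (j + 2) := by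
  cases j with
  | zero => rw [W_one]; exact s_mem_nonneg 2
  | succ j =>
    rw [W_add_two]
    have h := strands_le_nonneg (W_mem (j + 1))
    have h' := strands_le_nonneg (strands_mono (Nat.le_succ _) (inv_mem (W_mem j)))
    exact mul_mem (mul_mem (mul_mem h h') (s_mem_nonneg _)) h

/-! ### Absorbing sets of braids -/

/-- The admissible right factors of the braids of `G j`: the powers `σ_1^{a+1}` for `j = 0`, and
the elements of `G (j - 1) · d (j - 1)` for `j ≥ 1`. -/
def H : ℕ → Set BraidInf
  | 0 => {x | ∃ a : ℕ, x = s 1 ^ (a + 1)}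
  | j + 1 => {x | ∃ q ∈ nonneg (j + 2), ∃ k ∈ H j, x = q * s (j + 2) * k * d j}

/-- The set of the braids `q σ_{j+2} k` of `B_{j+3}` where `q` has an expression without
`σ_{j+2}⁻¹` and `k ∈ H j`. They are `σ`-positive, and they stay in the set when multiplied on the
right by anything that can follow them in a skew product. -/
def G (j : ℕ) : Set BraidInf :=
  {x | ∃ q ∈ nonneg (j + 2), ∃ k ∈ H j, x = q * s (j + 2) * k}

theorem mem_H_succ {j : ℕ} {x : BraidInf} : x ∈ H (j + 1) ↔ ∃ g ∈ G j, x = g * d j := by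
  constructor
  · rintro ⟨q, hq, k, hk, rfl⟩
    exact ⟨_, ⟨q, hq, k, hk, rfl⟩, rfl⟩
  · rintro ⟨_, ⟨q, hq, k, hk, rfl⟩, rfl⟩
    exact ⟨q, hq, k, hk, rfl⟩

theorem nonneg_mul_mem_G {j : ℕ} {q g : BraidInf} (hq : q ∈ nonneg (j + 2)) (hg : g ∈ G j) :
    q * g ∈ G j := by
  obtain ⟨q', hq', k, hk, rfl⟩ := hg
  exact ⟨q * q', mul_mem hq hq', k, hk, by simp only [mul_assoc]⟩

theorem H_subset_strands (j : ℕ) {k : BraidInf} (hk : k ∈ H j) : k ∈ strands (j + 2) := by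
  induction j generalizing k with
  | zero =>
    obtain ⟨a, rfl⟩ := hk
    exact pow_mem (s_mem_strands (by omega)) _
  | succ j ih =>
    obtain ⟨q, hq, k, hk, rfl⟩ := hk
    exact mul_mem (mul_mem (mul_mem (nonneg_le_strands hq) (s_mem_strands (by omega)))
      (strands_mono (by omega) (ih hk))) (d_mem j)

theorem G_subset_nonneg {j : ℕ} {g : BraidInf} (hg : g ∈ G j) : g ∈ nonneg (j + 2) := by
  obtain ⟨q, hq, k, hk, rfl⟩ := hg
  exact mul_mem (mul_mem hq (s_mem_nonneg _)) (strands_le_nonneg (H_subset_strands j hk))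

/-- The monoid of the braids `z` such that right multiplication by `z` preserves `G j`. -/
def R (j : ℕ) : Submonoid BraidInf where
  carrier := {z | ∀ g ∈ G j, g * z ∈ G j}
  one_mem' g hg := by rwa [mul_one]
  mul_mem' ha hb g hg := by
    rw [← mul_assoc]
    exact hb _ (ha _ hg)

theorem G_subset_R {j : ℕ} {z : BraidInf} (hz : z ∈ G j) : z ∈ R j :=
  fun _ hg => nonneg_mul_mem_G (G_subset_nonneg hg) hz

theorem exists_conj_G {j : ℕ} {g : BraidInf} (hg : g ∈ G j) :
    ∃ q ∈ nonneg (j + 3), ∃ g' ∈ G j, s (j + 3) * g * (s (j + 3))⁻¹ = q * s (j + 3) * g' := by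
  obtain ⟨q, hq, k, hk, rfl⟩ := hg
  refine ⟨s (j + 3) * q * (s (j + 3))⁻¹ * (s (j + 2))⁻¹,
    mul_mem (conj_mem_nonneg (by omega) hq)
      (strands_le_nonneg (inv_mem (s_mem_strands (by omega)))),
    s (j + 2) * k, ⟨1, one_mem _, k, hk, by rw [one_mul]⟩, ?_⟩
  have h1 := (strands_commute (H_subset_strands j hk) (show j + 2 < j + 3 by omega)).inv_right.eq
  have h2 : s (j + 3) * s (j + 2) * (s (j + 3))⁻¹ = (s (j + 2))⁻¹ * s (j + 3) * s (j + 2) :=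
    s_conj (by omega)
  calc s (j + 3) * (q * s (j + 2) * k) * (s (j + 3))⁻¹
      = s (j + 3) * q * s (j + 2) * (k * (s (j + 3))⁻¹) := by group
    _ = s (j + 3) * q * (s (j + 3))⁻¹ * (s (j + 3) * s (j + 2) * (s (j + 3))⁻¹) * k := by
        rw [h1]; group
    _ = _ := by rw [h2]; group

theorem s_two_conj_pow (a : ℕ) :
    s 2 * s 1 ^ (a + 1) * (s 2)⁻¹ = (s 1)⁻¹ * s 2 ^ a * s 2 * s 1 := by
  rw [s_conj_pow le_rfl, pow_succ]
  group

theorem inv_s_one_mul_pow_mem (a : ℕ) : (s 1)⁻¹ * s 2 ^ a ∈ nonneg 2 :=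
  mul_mem (strands_le_nonneg (inv_mem (s_mem_strands (by omega)))) (pow_mem (s_mem_nonneg 2) a)

theorem inv_d_mem_R (j : ℕ) : (d j)⁻¹ ∈ R j := by
  induction j with
  | zero =>
    rintro _ ⟨q, hq, _, ⟨a, rfl⟩, rfl⟩
    refine ⟨q * ((s 1)⁻¹ * s 2 ^ a), mul_mem hq (inv_s_one_mul_pow_mem a), s 1 ^ 2, ⟨1, rfl⟩, ?_⟩
    calc q * s 2 * s 1 ^ (a + 1) * ((s 1)⁻¹ * s 2)⁻¹
        = q * (s 2 * s 1 ^ (a + 1) * (s 2)⁻¹) * s 1 := by group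
      _ = _ := by rw [s_two_conj_pow, pow_two]; group
  | succ j ih =>
    rintro _ ⟨q, hq, k, hk, rfl⟩
    obtain ⟨g, hg, rfl⟩ := mem_H_succ.1 hk
    obtain ⟨q', hq', g', hg', h⟩ := exists_conj_G hg
    refine ⟨q * q', mul_mem hq hq', g', mem_H_succ.2 ⟨g' * (d j)⁻¹, ih _ hg', by group⟩, ?_⟩
    calc q * s (j + 3) * (g * d j) * (s (j + 3) * d j)⁻¹
        = q * (s (j + 3) * g * (s (j + 3))⁻¹) := by group
      _ = _ := by rw [h]; group

theorem G_subset_H {j : ℕ} {g : BraidInf} (hg : g ∈ G j) : g ∈ H (j + 1) :=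
  mem_H_succ.2 ⟨g * (d j)⁻¹, inv_d_mem_R j _ hg, by group⟩

theorem s_mul_mem_G {j : ℕ} {g : BraidInf} (hg : g ∈ G j) : s (j + 3) * g ∈ G (j + 1) :=
  ⟨1, one_mem _, g, G_subset_H hg, by rw [one_mul]⟩

theorem conj_mul_mem_G {j : ℕ} {g r : BraidInf} (hg : g ∈ G j) (hr : r ∈ R j) :
    s (j + 3) * g * (s (j + 3))⁻¹ * r ∈ G (j + 1) := by
  obtain ⟨q, hq, g', hg', h⟩ := exists_conj_G hg
  rw [h]
  exact ⟨q, hq, g' * r, G_subset_H (hr _ hg'), by group⟩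

theorem inv_W_mem_R (j : ℕ) : (W (j + 1))⁻¹ ∈ R j := by
  induction j with
  | zero =>
    rintro _ ⟨q, hq, _, ⟨a, rfl⟩, rfl⟩
    refine ⟨q * ((s 1)⁻¹ * s 2 ^ a), mul_mem hq (inv_s_one_mul_pow_mem a), s 1 ^ 1, ⟨0, rfl⟩, ?_⟩
    calc q * s 2 * s 1 ^ (a + 1) * (W 1)⁻¹
        = q * (s 2 * s 1 ^ (a + 1) * (s 2)⁻¹) := by rw [W_one]; group
      _ = _ := by rw [s_two_conj_pow]; group
  | succ j ih =>
    rintro _ ⟨q, hq, k, hk, rfl⟩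
    obtain ⟨g, hg, rfl⟩ := mem_H_succ.1 hk
    have h : q * s (j + 1 + 2) * (g * d j) * (W (j + 1 + 1))⁻¹ =
        q * (s (j + 3) * g * (s (j + 3))⁻¹ * (W (j + 1))⁻¹) := by
      rw [W_succ (j + 1), d_succ]; group
    rw [h]
    exact nonneg_mul_mem_G hq (conj_mul_mem_G hg ih)

theorem mem_R_succ {j : ℕ} {z : BraidInf} (hz : d j * z * (d j)⁻¹ ∈ R j) : z ∈ R (j + 1) := by
  rintro _ ⟨q, hq, k, hk, rfl⟩
  obtain ⟨g, hg, rfl⟩ := mem_H_succ.1 hk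
  exact ⟨q, hq, g * (d j * z * (d j)⁻¹) * d j, mem_H_succ.2 ⟨_, hz _ hg, rfl⟩, by group⟩

theorem conj_d_mem_G {x : BraidInf} (hx : d 0 * x * (d 0)⁻¹ ∈ G 0) (j : ℕ) :
    d j * x * (d j)⁻¹ ∈ G j := by
  induction j with
  | zero => exact hx
  | succ j ih =>
    have h := conj_mul_mem_G ih (one_mem (R j))
    rw [mul_one] at h
    convert h using 1
    rw [d_succ]; group

theorem mem_R_succ_of_conj_zero {x : BraidInf} (hx : d 0 * x * (d 0)⁻¹ ∈ G 0) (j : ℕ) :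
    x ∈ R (j + 1) :=
  mem_R_succ (G_subset_R (conj_d_mem_G hx j))

theorem d_mul_s {i : ℕ} (hi : 3 ≤ i) (j : ℕ) (h : i ≤ j + 1) :
    d j * s (i + 1) = s i * d j := by
  induction j with
  | zero => omega
  | succ j ih =>
    rcases Nat.lt_or_ge (j + 1) i with h' | h'
    · obtain rfl : i = j + 2 := by omega
      obtain ⟨l, rfl⟩ : ∃ l, j = l + 1 := ⟨j - 1, by omega⟩
      have hc := (strands_commute (d_mem l) (show l + 3 < l + 4 by omega)).eq
      have hb : s (l + 3) * s (l + 4) * s (l + 3) = s (l + 4) * s (l + 3) * s (l + 4) :=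
        s_braid (by omega)
      change s (l + 4) * (s (l + 3) * d l) * s (l + 4) = s (l + 3) * (s (l + 4) * (s (l + 3) * d l))
      calc s (l + 4) * (s (l + 3) * d l) * s (l + 4)
          = s (l + 4) * s (l + 3) * (d l * s (l + 4)) := by group
        _ = s (l + 4) * s (l + 3) * s (l + 4) * d l := by rw [hc]; group
        _ = _ := by rw [← hb]; group
    · rw [d_succ, mul_assoc, ih h', ← mul_assoc, ← mul_assoc,
        (s_comm (show i + 2 ≤ j + 3 by omega)).eq]

/-- The braid relation `σ_1 σ_2 σ_1 = σ_2 σ_1 σ_2`, as a rule for cancelling `σ_2⁻¹`. -/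
theorem s_two_s_one_inv_s_two : s 2 * s 1 * (s 2)⁻¹ = (s 1)⁻¹ * s 2 * s 1 := s_conj le_rfl

theorem conj_d_zero_s_one : d 0 * s 1 * (d 0)⁻¹ ∈ G 0 := by
  refine ⟨(s 1)⁻¹ * (s 1)⁻¹, ?_, s 1 ^ 2, ⟨1, rfl⟩, ?_⟩
  · have := strands_le_nonneg (inv_mem (s_mem_strands (show 1 < 2 by omega)))
    exact mul_mem this this
  · calc d 0 * s 1 * (d 0)⁻¹ = (s 1)⁻¹ * (s 2 * s 1 * (s 2)⁻¹) * s 1 := by rw [d]; group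
      _ = _ := by rw [s_two_s_one_inv_s_two, pow_two]; group

theorem conj_d_zero_s_two : d 0 * s 2 * (d 0)⁻¹ ∈ G 0 := by
  refine ⟨(s 1)⁻¹, ?_, s 1 ^ 1, ⟨0, rfl⟩, ?_⟩
  · exact strands_le_nonneg (inv_mem (s_mem_strands (show 1 < 2 by omega)))
  · rw [d]; group

theorem conj_d_zero_conj : d 0 * ((s 1)⁻¹ * s 2 * s 1) * (d 0)⁻¹ ∈ G 0 := by
  have hn := strands_le_nonneg (inv_mem (s_mem_strands (show 1 < 2 by omega)))
  refine ⟨(s 1)⁻¹ * s 2 * (s 1)⁻¹ * (s 1)⁻¹, ?_, s 1 ^ 2, ⟨1, rfl⟩, ?_⟩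
  · exact mul_mem (mul_mem (mul_mem hn (s_mem_nonneg 2)) hn) hn
  · have h1 : s 2 * (s 1)⁻¹ * s 2 * s 1 * (s 2)⁻¹ = s 2 * (s 1)⁻¹ * (s 1)⁻¹ * s 2 * s 1 := by
      calc s 2 * (s 1)⁻¹ * s 2 * s 1 * (s 2)⁻¹
          = s 2 * (s 1)⁻¹ * (s 2 * s 1 * (s 2)⁻¹) := by group
        _ = _ := by rw [s_two_s_one_inv_s_two]; group
    calc d 0 * ((s 1)⁻¹ * s 2 * s 1) * (d 0)⁻¹
        = (s 1)⁻¹ * (s 2 * (s 1)⁻¹ * s 2 * s 1 * (s 2)⁻¹) * s 1 := by rw [d]; group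
      _ = _ := by rw [h1, pow_two]; group

theorem d_conj_s_three (j : ℕ) : d (j + 1) * s 3 * (d (j + 1))⁻¹ = (s 1)⁻¹ * s 2 * s 1 := by
  induction j with
  | zero =>
    have h1 : (s 1)⁻¹ * s 3 = s 3 * (s 1)⁻¹ :=
      ((s_comm (show 1 + 2 ≤ 3 by omega)).inv_left).eq
    have h2 : s 3 * s 2 * (s 3)⁻¹ = (s 2)⁻¹ * s 3 * s 2 := s_conj (by omega)
    have h3 : s 2 * s 3 * s 2 = s 3 * s 2 * s 3 := s_braid (by omega)
    have h4 : (s 3)⁻¹ * s 2 * s 3 = s 2 * s 3 * (s 2)⁻¹ := by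
      rw [eq_mul_inv_iff_mul_eq, mul_assoc, mul_assoc, inv_mul_eq_iff_eq_mul, ← mul_assoc,
        ← mul_assoc, h3]
    have h5 : s 3 * (s 1)⁻¹ * (s 3)⁻¹ = (s 1)⁻¹ := by rw [← h1]; group
    have h6 : s 1 * (s 3)⁻¹ = (s 3)⁻¹ * s 1 := ((s_comm (show 1 + 2 ≤ 3 by omega)).inv_right).eq
    calc s 3 * ((s 1)⁻¹ * s 2) * s 3 * (s 3 * ((s 1)⁻¹ * s 2))⁻¹
        = s 3 * (s 1)⁻¹ * (s 2 * s 3 * (s 2)⁻¹) * (s 1 * (s 3)⁻¹) := by group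
      _ = s 3 * (s 1)⁻¹ * (s 3)⁻¹ * s 2 * s 1 := by rw [← h4, h6]; group
      _ = _ := by rw [h5]
  | succ j ih =>
    have h : Commute ((s 1)⁻¹ * s 2 * s 1) (s (j + 4)) :=
      strands_commute (k := 3) (mul_mem (mul_mem (inv_mem (s_mem_strands (by omega)))
        (s_mem_strands (by omega))) (s_mem_strands (by omega))) (by omega)
    calc s (j + 4) * d (j + 1) * s 3 * (s (j + 4) * d (j + 1))⁻¹
        = s (j + 4) * (d (j + 1) * s 3 * (d (j + 1))⁻¹) * (s (j + 4))⁻¹ := by group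
      _ = _ := by rw [ih, ← h.eq, mul_inv_cancel_right]

theorem s_mem_R {i j : ℕ} (h : i < j + 2) : s i ∈ R j := by
  rcases Nat.eq_zero_or_pos i with rfl | hi
  · exact one_mem _
  induction j generalizing i with
  | zero =>
    obtain rfl : i = 1 := by omega
    rintro _ ⟨q, hq, _, ⟨a, rfl⟩, rfl⟩
    exact ⟨q, hq, _, ⟨a + 1, rfl⟩, by rw [pow_succ _ (a + 1)]; group⟩
  | succ j ih =>
    obtain rfl | rfl | rfl | h4 : i = 1 ∨ i = 2 ∨ i = 3 ∨ 4 ≤ i := by omega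
    · exact mem_R_succ_of_conj_zero conj_d_zero_s_one j
    · exact mem_R_succ_of_conj_zero conj_d_zero_s_two j
    · obtain ⟨l, rfl⟩ : ∃ l, j = l + 1 := ⟨j - 1, by omega⟩
      apply mem_R_succ
      rw [d_conj_s_three]
      exact mem_R_succ_of_conj_zero conj_d_zero_conj l
    · obtain ⟨i, rfl⟩ : ∃ l, i = l + 1 := ⟨i - 1, by omega⟩
      apply mem_R_succ
      rw [d_mul_s (by omega) j (by omega), mul_inv_cancel_right]
      exact ih (by omega) (by omega)

theorem positive_le_R {j : ℕ} {b : BraidInf} (hb : b ∈ positive (j + 2)) : b ∈ R j := by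
  refine (Submonoid.closure_le (S := R j)).2 ?_ hb
  rintro _ ⟨i, hi, rfl⟩
  exact s_mem_R hi

theorem d_mul_W_mem_G (j : ℕ) : d j * W j ∈ G j := by
  induction j with
  | zero =>
    exact ⟨(s 1)⁻¹, strands_le_nonneg (inv_mem (s_mem_strands (show 1 < 2 by omega))), s 1 ^ 1,
      ⟨0, rfl⟩, by rw [d, W]; group⟩
  | succ j ih =>
    refine ⟨1, one_mem _, _, mem_H_succ.2 ⟨_, ih, rfl⟩, ?_⟩
    rw [W_succ, d_succ]; group

theorem W_mem_R (j : ℕ) : W j ∈ R j := by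
  cases j with
  | zero => exact s_mem_R (by omega)
  | succ j =>
    apply mem_R_succ
    rw [W_succ, ← mul_assoc, mul_inv_cancel_right]
    exact G_subset_R (d_mul_W_mem_G j)

/-- Conjugation by the separators carries the absorbing sets into one another. -/
theorem conj_W_succ {j : ℕ} {g : BraidInf} (hg : W (j + 1) * g * (W (j + 1))⁻¹ ∈ G j) :
    W (j + 2) * g * (W (j + 2))⁻¹ ∈ G (j + 1) := by
  have h : W (j + 2) * g * (W (j + 2))⁻¹ = W (j + 1) * (W j)⁻¹ *
      (s (j + 3) * (W (j + 1) * g * (W (j + 1))⁻¹) * (s (j + 3))⁻¹ *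
        (W j * (W (j + 1))⁻¹)) := by
    rw [W_add_two]; group
  rw [h]
  refine nonneg_mul_mem_G (strands_le_nonneg (mul_mem (W_mem (j + 1))
    (inv_mem (strands_mono (by omega) (W_mem j))))) ?_
  exact conj_mul_mem_G hg (mul_mem (W_mem_R j) (inv_W_mem_R j))

theorem conj_W_mem_G {j : ℕ} {g : BraidInf} (hg : g ∈ G j) :
    W (j + 1) * g * (W (j + 1))⁻¹ ∈ G j :=
  inv_W_mem_R j _ (nonneg_mul_mem_G (W_succ_mem_nonneg j) hg)

end BraidInf

namespace BraidInf

/-! ### The Garside braids and the separated flip -/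

/-- The braid `σ_k σ_{k-1} ⋯ σ_1`. -/
def cox : ℕ → BraidInf
  | 0 => 1
  | k + 1 => s (k + 1) * cox k

/-- Garside's braid `Δ_k`, the half-turn of the `k` strands of `B_k`. -/
def garside : ℕ → BraidInf
  | 0 => 1
  | k + 1 => garside k * cox k

/-- The braid `σ_1 σ_2² ⋯ σ_k² σ_{k+1}` of `B_{k+2}`, as the product of the `σ_i σ_{i+1}` for
`i = 1, …, k`. -/
def sepLeft : ℕ → BraidInf
  | 0 => 1
  | k + 1 => sepLeft k * s (k + 1) * s (k + 2)

/-- The reverse `σ_{k+1} σ_k² ⋯ σ_2² σ_1` of `sepLeft k`. -/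
def sepRight : ℕ → BraidInf
  | 0 => 1
  | k + 1 => s (k + 2) * s (k + 1) * sepRight k

theorem cox_mem (k : ℕ) : cox k ∈ strands (k + 1) := by
  induction k with
  | zero => exact one_mem _
  | succ k ih => exact mul_mem (s_mem_strands (by omega)) (strands_mono (by omega) ih)

theorem garside_mem (k : ℕ) : garside k ∈ strands k := by
  induction k with
  | zero => exact one_mem _
  | succ k ih => exact mul_mem (strands_mono (by omega) ih) (cox_mem k)

theorem sepLeft_mem (k : ℕ) : sepLeft k ∈ positive (k + 2) := by
  induction k with
  | zero => exact one_mem _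
  | succ k ih => exact mul_mem (mul_mem (positive_mono (by omega) ih)
      (s_mem_positive (by omega))) (s_mem_positive (by omega))

theorem sepRight_mem_G (j : ℕ) : sepRight (j + 1) ∈ G j := by
  induction j with
  | zero => exact ⟨1, one_mem _, s 1 ^ 1, ⟨0, rfl⟩, by simp [sepRight]⟩
  | succ j ih =>
    have h := s_mul_mem_G (nonneg_mul_mem_G (s_mem_nonneg (j + 2)) ih)
    rwa [← mul_assoc] at h

theorem sepRight_mem (k : ℕ) : sepRight k ∈ positive (k + 2) := by
  induction k with
  | zero => exact one_mem _
  | succ k ih => exact mul_mem (mul_mem (s_mem_positive (by omega))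
      (s_mem_positive (by omega))) (positive_mono (by omega) ih)

theorem cox_mul_s {i n : ℕ} (hi : 1 ≤ i) (h : i < n) : cox n * s (i + 1) = s i * cox n := by
  induction n with
  | zero => omega
  | succ n ih =>
    rcases Nat.lt_or_ge i n with h' | h'
    · rw [cox, mul_assoc, ih h', ← mul_assoc, ← mul_assoc,
        (s_comm (show i + 2 ≤ n + 1 by omega)).eq]
    · obtain rfl : i = n := by omega
      obtain ⟨l, rfl⟩ : ∃ l, i = l + 1 := ⟨i - 1, by omega⟩
      have hc := (strands_commute (cox_mem l) (show l + 1 < l + 2 by omega)).eq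
      have hb : s (l + 1) * s (l + 2) * s (l + 1) = s (l + 2) * s (l + 1) * s (l + 2) :=
        s_braid (by omega)
      change s (l + 2) * (s (l + 1) * cox l) * s (l + 2) =
        s (l + 1) * (s (l + 2) * (s (l + 1) * cox l))
      calc s (l + 2) * (s (l + 1) * cox l) * s (l + 2)
          = s (l + 2) * s (l + 1) * (cox l * s (l + 2)) := by group
        _ = s (l + 2) * s (l + 1) * s (l + 2) * cox l := by rw [hc]; group
        _ = _ := by rw [← hb]; group

theorem cox_mul_cox_mul_s_one (n : ℕ) :
    cox (n + 1) * cox (n + 1) = cox n * cox (n + 1) * s 1 := by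
  have h : ∀ k ≤ n, cox (n + 1) * cox (k + 1) = cox k * cox (n + 1) * s 1 := by
    intro k hk
    induction k with
    | zero => simp [cox]
    | succ k ih =>
      have h1 : cox (n + 1) * s (k + 2) = s (k + 1) * cox (n + 1) :=
        cox_mul_s (by omega) (by omega)
      calc cox (n + 1) * (s (k + 2) * cox (k + 1))
          = cox (n + 1) * s (k + 2) * cox (k + 1) := by group
        _ = s (k + 1) * (cox (n + 1) * cox (k + 1)) := by rw [h1]; group
        _ = _ := by rw [ih (by omega), cox.eq_def (k + 1)]; group
  exact h n le_rfl

theorem garside_mul_s {n i : ℕ} (hi : 1 ≤ i) (h : i < n) :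
    garside n * s i = s (n - i) * garside n := by
  induction n generalizing i with
  | zero => omega
  | succ n ih =>
    obtain ⟨i, rfl⟩ : ∃ l, i = l + 1 := ⟨i - 1, by omega⟩
    rcases Nat.eq_zero_or_pos i with rfl | hi'
    · obtain ⟨m, rfl⟩ : ∃ l, n = l + 1 := ⟨n - 1, by omega⟩
      have hc := (strands_commute (garside_mem m) (show m < m + 1 by omega)).eq
      have hx := cox_mul_cox_mul_s_one m
      have h1 : garside (m + 2) = garside m * cox m * cox (m + 1) := rfl
      calc garside (m + 2) * s 1 = garside m * (cox m * cox (m + 1) * s 1) := by rw [h1]; group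
        _ = garside m * s (m + 1) * cox m * cox (m + 1) := by rw [← hx, cox]; group
        _ = _ := by rw [hc, h1]; simp only [Nat.add_sub_cancel]; group
    · rw [garside, mul_assoc, cox_mul_s hi' (by omega), ← mul_assoc, ih hi' (by omega),
        Nat.add_sub_add_right, mul_assoc]

theorem d_mul_sepLeft (k : ℕ) : d k * sepLeft (k + 1) = sepLeft k * cox (k + 2) := by
  induction k with
  | zero =>
    have h : s 1 * s 2 * s 1 = s 2 * s 1 * s 2 := s_braid le_rfl
    calc (s 1)⁻¹ * s 2 * (1 * s 1 * s 2) = (s 1)⁻¹ * (s 2 * s 1 * s 2) := by group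
      _ = 1 * (s 2 * (s 1 * 1)) := by rw [← h]; group
  | succ k ih =>
    have hc := (strands_commute (positive_le_strands (sepLeft_mem k))
      (show k + 2 < k + 3 by omega)).eq
    have h1 : cox (k + 3) * s (k + 2) = s (k + 1) * cox (k + 3) := cox_mul_s (by omega) (by omega)
    have h2 : cox (k + 3) * s (k + 3) = s (k + 2) * cox (k + 3) := cox_mul_s (by omega) (by omega)
    calc s (k + 3) * d k * (sepLeft (k + 1) * s (k + 2) * s (k + 3))
        = s (k + 3) * (d k * sepLeft (k + 1)) * s (k + 2) * s (k + 3) := by group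
      _ = sepLeft k * (cox (k + 3) * s (k + 2)) * s (k + 3) := by
          rw [ih, ← mul_assoc, ← hc, cox.eq_def (k + 3)]; group
      _ = sepLeft k * s (k + 1) * (cox (k + 3) * s (k + 3)) := by rw [h1]; group
      _ = _ := by rw [h2, sepLeft]; group

theorem W_mul_sepLeft (k : ℕ) : W k * sepLeft k = garside (k + 2) := by
  induction k with
  | zero => simp [W, sepLeft, garside, cox]
  | succ k ih => rw [W_succ, mul_assoc, d_mul_sepLeft, ← mul_assoc, ih]; rfl

theorem garside_mul_sepLeft_mul (a k : ℕ) :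
    garside (a + k + 2) * sepLeft k * (garside (a + k + 2))⁻¹ * sepRight a =
      sepRight (a + k) := by
  induction k generalizing a with
  | zero => simp [sepLeft]
  | succ k ih =>
    have h1 := garside_mul_s (n := a + 1 + k + 2) (i := k + 1) (by omega) (by omega)
    have h2 := garside_mul_s (n := a + 1 + k + 2) (i := k + 2) (by omega) (by omega)
    rw [show a + 1 + k + 2 - (k + 1) = a + 2 by omega] at h1
    rw [show a + 1 + k + 2 - (k + 2) = a + 1 by omega] at h2
    have h := ih (a + 1)
    rw [show a + (k + 1) = a + 1 + k by omega, ← h, sepLeft, sepRight]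
    generalize garside (a + 1 + k + 2) = D at h1 h2
    have h1' : D * s (k + 1) * D⁻¹ = s (a + 2) := by rw [h1]; group
    have h2' : D * s (k + 2) * D⁻¹ = s (a + 1) := by rw [h2]; group
    rw [← h1', ← h2']; group

theorem garside_mul_sepLeft (k : ℕ) :
    garside (k + 2) * sepLeft k = sepRight k * garside (k + 2) := by
  have h := garside_mul_sepLeft_mul 0 k
  rw [Nat.zero_add, sepRight, mul_one, mul_inv_eq_iff_eq_mul] at h
  exact h

theorem sepRight_mul_W (k : ℕ) : sepRight k * W k = garside (k + 2) := by
  have h := garside_mul_sepLeft k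
  rw [← W_mul_sepLeft k, ← mul_assoc] at h
  rw [← mul_right_cancel h, W_mul_sepLeft]

theorem garside_sq_mul_s {n i : ℕ} (hi : 1 ≤ i) (h : i < n) :
    garside n ^ 2 * s i = s i * garside n ^ 2 := by
  rw [pow_two, mul_assoc, garside_mul_s hi h, ← mul_assoc, garside_mul_s (by omega) (by omega),
    Nat.sub_sub_self h.le, mul_assoc]

theorem garside_sq_commute {n : ℕ} {g : BraidInf} (hg : g ∈ strands n) :
    Commute (garside n ^ 2) g := by
  induction hg using Subgroup.closure_induction with
  | mem x hx =>
    obtain ⟨i, hi, rfl⟩ := hx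
    rcases Nat.eq_zero_or_pos i with rfl | h
    · exact Commute.one_right _
    · exact garside_sq_mul_s h hi
  | one => exact Commute.one_right _
  | mul x y _ _ hx hy => exact hx.mul_right hy
  | inv x _ hx => exact hx.inv_right

theorem sepLeft_garside_conj_sepRight (k : ℕ) (g : BraidInf) :
    sepLeft k * (garside (k + 2) * g * (garside (k + 2))⁻¹) * sepRight k =
      garside (k + 2) ^ 2 * (W k)⁻¹ * g * (W k)⁻¹ := by
  have h1 := W_mul_sepLeft k
  have h2 := sepRight_mul_W k
  have h3 := garside_mul_sepLeft k
  have h4 : sepLeft k = (W k)⁻¹ * garside (k + 2) := by rw [← h1]; group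
  have h5 : sepRight k = garside (k + 2) * (W k)⁻¹ := by rw [← h2]; group
  have h6 : (W k)⁻¹ * garside (k + 2) * garside (k + 2) = garside (k + 2) ^ 2 * (W k)⁻¹ := by
    have := (garside_sq_commute (strands_mono (le_refl _) (inv_mem (W_mem k)))).eq
    rw [this, pow_two, mul_assoc]
  calc _ = (W k)⁻¹ * garside (k + 2) * garside (k + 2) * g * (W k)⁻¹ := by rw [h4, h5]; group
    _ = _ := by rw [h6]

end BraidInf

namespace Braid

open BraidInf

theorem artinMap_of {S T : Set ℕ} (f : S → T)
    (hf : ∀ i j : S, |((f i : ℕ) : ℤ) - ((f j : ℕ) : ℤ)| = |((i : ℕ) : ℤ) - ((j : ℕ) : ℤ)|)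
    (i : S) : ArtinBraid.map f hf (PresentedGroup.of i) = PresentedGroup.of (f i) :=
  PresentedGroup.toGroup.of (artinRels_lift_eq_one f hf)

theorem toInf_of {n : ℕ} (i : Set.Ico 1 n) : toInf n (PresentedGroup.of i) = s i.1 := by
  rw [s, dif_pos i.2.1]
  exact artinMap_of _ _ _

theorem toInf_σ {n i : ℕ} (h : i < n) : toInf n (σ n i) = s i := by
  by_cases hi : 1 ≤ i
  · rw [σ, dif_pos ⟨hi, h⟩, toInf_of]
  · rw [σ, dif_neg (fun h' => hi h'.1), map_one, s, dif_neg hi]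

theorem toInf_incl (n : ℕ) (b : Braid (n - 1)) : toInf n (incl n b) = toInf (n - 1) b := by
  have h : (toInf n).comp (incl n) = toInf (n - 1) := by
    refine PresentedGroup.ext fun i => ?_
    have h1 : incl n (PresentedGroup.of i) =
        PresentedGroup.of ⟨i.1, i.2.1, by have := i.2.2; omega⟩ := artinMap_of _ _ _
    rw [MonoidHom.comp_apply, h1, toInf_of, toInf_of]
  exact DFunLike.congr_fun h b

theorem toInf_flip (n : ℕ) (b : Braid n) :
    toInf n (flip n b) = garside n * toInf n b * (garside n)⁻¹ := by
  have h : (toInf n).comp (flip n) = (MulAut.conj (garside n)).toMonoidHom.comp (toInf n) := by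
    refine PresentedGroup.ext fun i => ?_
    have h1 : flip n (PresentedGroup.of i) = PresentedGroup.of ⟨n - i.1, by
        have h1 := i.2.1; have h2 := i.2.2; constructor <;> omega⟩ := artinMap_of _ _ _
    rw [MonoidHom.comp_apply, h1, toInf_of, MonoidHom.comp_apply, toInf_of]
    change s (n - i.1) = garside n * s i.1 * (garside n)⁻¹
    rw [garside_mul_s i.2.1 i.2.2, mul_inv_cancel_right]
  exact DFunLike.congr_fun h b

theorem toInf_positive {n : ℕ} {b : Braid n} (hb : b ∈ Braid.positive n) :
    toInf n b ∈ BraidInf.positive n := by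
  refine (Submonoid.closure_le (S := (BraidInf.positive n).comap (toInf n))).2 ?_ hb
  rintro _ ⟨i, rfl⟩
  change toInf n _ ∈ BraidInf.positive n
  rw [toInf_of]
  exact s_mem_positive i.2.2

theorem toInf_mem_strands {n : ℕ} (b : Braid n) : toInf n b ∈ strands n := by
  have h : (⊤ : Subgroup (Braid n)) ≤ (strands n).comap (toInf n) := by
    rw [← PresentedGroup.closure_range_of, Subgroup.closure_le]
    rintro _ ⟨i, rfl⟩
    change toInf n _ ∈ strands n
    rw [toInf_of]
    exact s_mem_strands i.2.2
  exact h (Subgroup.mem_top b)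

theorem toInf_sepLeft (j : ℕ) :
    toInf (j + 3) (σ (j + 3) 1 * ((List.range' 2 j).map (fun i => σ (j + 3) i ^ 2)).prod *
      σ (j + 3) (j + 2)) = sepLeft (j + 1) := by
  have h : ∀ k ≤ j, toInf (j + 3) (σ (j + 3) 1 *
      ((List.range' 2 k).map (fun i => σ (j + 3) i ^ 2)).prod) * s (k + 2) = sepLeft (k + 1) := by
    intro k hk
    induction k with
    | zero => simp [toInf_σ, sepLeft]
    | succ k ih =>
      rw [List.range'_concat, List.map_append, List.prod_append, ← mul_assoc, map_mul,
        sepLeft, ← ih (by omega)]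
      simp only [List.map_cons, List.map_nil, List.prod_cons, List.prod_nil, mul_one, one_mul,
        map_pow]
      rw [toInf_σ (by omega), show 2 + k = k + 2 by omega, pow_two]
      group
  rw [map_mul, toInf_σ (by omega)]
  exact h j le_rfl

theorem toInf_sepRight (j : ℕ) :
    toInf (j + 3) (σ (j + 3) (j + 2) *
      ((List.range' 2 j).reverse.map (fun i => σ (j + 3) i ^ 2)).prod * σ (j + 3) 1) =
        sepRight (j + 1) := by
  have h : ∀ k ≤ j, s (k + 2) * toInf (j + 3)
      (((List.range' 2 k).reverse.map (fun i => σ (j + 3) i ^ 2)).prod * σ (j + 3) 1) =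
        sepRight (k + 1) := by
    intro k hk
    induction k with
    | zero => simp [toInf_σ, sepRight]
    | succ k ih =>
      rw [List.range'_concat, List.reverse_append, sepRight, ← ih (by omega)]
      simp only [List.reverse_cons, List.reverse_nil, List.nil_append, List.cons_append,
        List.map_cons, List.prod_cons, one_mul, map_pow, map_mul]
      rw [toInf_σ (by omega), show 2 + k = k + 2 by omega, pow_two]
      group
  rw [mul_assoc, map_mul, toInf_σ (by omega)]
  exact h j le_rfl

theorem toInf_sepFlip (j : ℕ) (b : Braid (j + 2)) :
    toInf (j + 3) (sepFlip (j + 3) b) = sepLeft (j + 1) *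
      (garside (j + 3) * toInf (j + 2) b * (garside (j + 3))⁻¹) * sepRight (j + 1) := by
  have h := toInf_incl (j + 3) b
  rw [sepFlip, map_mul, map_mul, toInf_flip, h]
  exact congrArg₂ (fun x y => x * _ * y) (toInf_sepLeft j) (toInf_sepRight j)

theorem toInf_sepFlip_eq (j : ℕ) (b : Braid (j + 2)) :
    toInf (j + 3) (sepFlip (j + 3) b) =
      garside (j + 3) ^ 2 * (W (j + 1))⁻¹ * toInf (j + 2) b * (W (j + 1))⁻¹ := by
  rw [toInf_sepFlip]
  exact sepLeft_garside_conj_sepRight (j + 1) _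

end Braid

/-! ### First letters of reduced words in a free group -/

namespace FreeGroup

theorem mk_mem {α : Type*} {K : Subgroup (FreeGroup α)} {L : List (α × Bool)} (h : ∀ l ∈ L, of l.1 ∈ K) :
    mk L ∈ K := by
  induction L with
  | nil => exact one_mem K
  | cons l L ih =>
    rw [← List.singleton_append, ← mul_mk]
    refine mul_mem ?_ (ih fun l' hl' => h l' (List.mem_cons_of_mem _ hl'))
    have hl := h l List.mem_cons_self
    obtain ⟨a, _ | _⟩ := l
    · exact inv_mem hl
    · exact hl

variable {α : Type*} [DecidableEq α]

/-- The subgroup of the elements whose reduced word does not involve the generator `y`. -/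
def avoiding (y : α) : Subgroup (FreeGroup α) where
  carrier := {g | ∀ l ∈ g.toWord, l.1 ≠ y}
  one_mem' := by simp
  mul_mem' := by
    intro a b ha hb l hl
    rcases List.mem_append.1 ((toWord_mul_sublist a b).subset hl) with h | h
    exacts [ha l h, hb l h]
  inv_mem' := by
    intro a ha l hl
    rw [toWord_inv, invRev, List.mem_reverse, List.mem_map] at hl
    obtain ⟨l', hl', rfl⟩ := hl
    exact ha l' hl'

theorem of_mem_avoiding {x y : α} (h : x ≠ y) : of x ∈ avoiding y := by
  intro l hl
  rw [toWord_of, List.mem_singleton] at hl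
  rw [hl]
  exact h

theorem map_mem_avoiding {x y : α} {θ : FreeGroup α →* FreeGroup α}
    (hθ : ∀ z ≠ y, θ (of z) ∈ avoiding x) {f : FreeGroup α} (hf : f ∈ avoiding y) :
    θ f ∈ avoiding x := by
  have h : mk f.toWord ∈ (avoiding x).comap θ := mk_mem fun l hl => hθ l.1 (hf l hl)
  rwa [mk_toWord] at h

theorem mul_notMem_startsWith {y : α} {e e' : Bool} {f g : FreeGroup α} (hf : f ∈ avoiding y)
    (hf1 : f ≠ 1) (hg : g = 1 ∨ g ∈ startsWith (y, e')) : f * g ∉ startsWith (y, e) := by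
  have hne : f.toWord ≠ [] := fun h => hf1 (toWord_eq_nil_iff.1 h)
  have hred : (f * g).toWord = f.toWord ++ g.toWord := by
    rw [toWord_mul]
    refine IsReduced.reduce_eq (List.isChain_append.2 ⟨isReduced_toWord, isReduced_toWord, ?_⟩)
    intro a ha b hb hab
    rcases hg with rfl | hg
    · simp at hb
    · rw [startsWith, Set.mem_ofPred_eq, ← List.head?_eq_getElem?] at hg
      rw [hg, Option.mem_some_iff] at hb
      exact absurd (hab.trans (congrArg Prod.fst hb).symm) (hf a (List.mem_of_getLast? ha))
  intro h
  rw [startsWith, Set.mem_ofPred_eq, hred, ← List.head?_eq_getElem?,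
    List.head?_append_of_ne_nil _ hne] at h
  exact hf _ (List.mem_of_mem_head? h) rfl

/-- An endomorphism that maps `y` to `x` and the free factor complementary to `y` injectively into
the one complementary to `x` respects the first letters `y^{±1}` and `x^{±1}`, by the normal form
in a free product. -/
theorem map_mem_startsWith {x y : α} {θ : FreeGroup α →* FreeGroup α}
    (hinj : Function.Injective θ) (hy : θ (of y) = of x)
    (hθ : ∀ z ≠ y, θ (of z) ∈ avoiding x) {e : Bool} {g : FreeGroup α}
    (hg : g ∈ startsWith (y, e)) : θ g ∈ startsWith (x, e) := by
  have key : ∀ (n : ℕ) (L : List (α × Bool)) (e : Bool), L.length ≤ n → IsReduced ((y, e) :: L) →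
      θ (mk ((y, e) :: L)) ∈ startsWith (x, e) := by
    intro n
    induction n with
    | zero =>
      intro L e hL _
      obtain rfl : L = [] := List.eq_nil_of_length_eq_zero (by omega)
      have : θ (mk [(y, e)]) = mk [(x, e)] := by
        cases e
        · change θ (of y)⁻¹ = (of x)⁻¹
          rw [_root_.map_inv, hy]
        · exact hy
      rw [this, startsWith, Set.mem_ofPred_eq]
      simp
    | succ n ih =>
      intro L e hL hred
      have hye : θ (mk [(y, e)]) = mk [(x, e)] := by
        cases e
        · change θ (of y)⁻¹ = (of x)⁻¹
          rw [_root_.map_inv, hy]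
        · exact hy
      rw [← List.singleton_append, ← mul_mk, _root_.map_mul, hye]
      apply startsWith_mk_mul
      -- `A` is the longest prefix of `L` without `y^{±1}`, and `C` is the rest.
      set A := L.takeWhile (fun l => decide (l.1 ≠ y)) with hA
      set C := L.dropWhile (fun l => decide (l.1 ≠ y)) with hC
      have hAC : A ++ C = L := List.takeWhile_append_dropWhile
      have hLred : IsReduced L := List.IsChain.tail hred
      have hAred : IsReduced A := (List.isChain_append.1 (hAC ▸ hLred)).1
      have hCred : IsReduced C := (List.isChain_append.1 (hAC ▸ hLred)).2.1
      have hAmem : mk A ∈ avoiding y := mk_mem fun l hl =>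
        of_mem_avoiding (by simpa using List.mem_takeWhile_imp hl)
      have hCstart : C = [] ∨ ∃ e' C', C = (y, e') :: C' := by
        rcases h : C with _ | ⟨⟨c, e'⟩, C'⟩
        · exact Or.inl rfl
        · right
          have := List.head?_dropWhile_not (fun l : α × Bool => decide (l.1 ≠ y)) L
          rw [← hC, h] at this
          simp at this
          exact ⟨e', C', by rw [this]⟩
      have hθC : θ (mk C) = 1 ∨ ∃ e' C', C = (y, e') :: C' ∧ θ (mk C) ∈ startsWith (x, e') := by
        rcases hCstart with h | ⟨e', C', h⟩
        · left
          rw [h]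
          exact _root_.map_one θ
        · right
          refine ⟨e', C', h, ?_⟩
          have hlen := congrArg List.length hAC
          rw [List.length_append, h, List.length_cons] at hlen
          rw [h]
          exact ih C' e' (by omega) (h ▸ hCred)
      rw [← hAC, ← mul_mk, _root_.map_mul]
      by_cases hA1 : mk A = 1
      · have hAnil : A = [] := by
          rw [← hAred.reduce_eq, ← toWord_mk, hA1, toWord_one]
        rw [hA1, _root_.map_one, one_mul]
        rcases hθC with h | ⟨e', C', h, h'⟩
        · rw [h]
          exact fun h1 => startsWith.ne_one _ h1 rfl
        · rw [← hAC, hAnil, List.nil_append, h] at hred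
          have he : e = e' := (isReduced_cons_cons.1 hred).1 rfl
          subst he
          intro h1
          rw [startsWith, Set.mem_ofPred_eq] at h1 h'
          rw [h1] at h'
          simp at h'
      · have h1 : θ (mk A) ≠ 1 := fun h => hA1 (hinj (h.trans (_root_.map_one θ).symm))
        rcases hθC with h | ⟨e', C', -, h'⟩
        · exact mul_notMem_startsWith (e' := e) (map_mem_avoiding hθ hAmem) h1 (Or.inl h)
        · exact mul_notMem_startsWith (map_mem_avoiding hθ hAmem) h1 (Or.inr h')
  rw [startsWith, Set.mem_ofPred_eq, ← List.head?_eq_getElem?, List.head?_eq_some_iff] at hg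
  obtain ⟨L, hL⟩ := hg
  have h := key L.length L e le_rfl (hL ▸ isReduced_toWord)
  rwa [← hL, mk_toWord] at h

/-- If a reduced word starts with `x⁻¹`, then conjugating by another generator `y` gives an
element starting with `y⁻¹`. -/
theorem inv_of_mul_mul_of_mem_startsWith {x y : α} (hxy : x ≠ y) {g : FreeGroup α}
    (hg : g ∈ startsWith (x, false)) : (of y)⁻¹ * g * of y ∈ startsWith (y, false) := by
  rw [mul_assoc]
  refine startsWith_mk_mul (w := (y, false)) _ fun h => ?_
  rw [startsWith, Set.mem_ofPred_eq, ← List.head?_eq_getElem?] at h hg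
  rcases List.eq_nil_or_concat g.toWord with h0 | ⟨L, l, hl⟩
  · simp [h0] at hg
  · rw [List.concat_eq_append] at hl
    by_cases hly : l = (y, false)
    · -- The last letter `y⁻¹` of `g` cancels, which leaves the first letter `x⁻¹`.
      have hL : IsReduced L := (List.isChain_append.1 (hl ▸ isReduced_toWord)).1
      have hgy : g * of y = mk L := by
        rw [← mk_toWord (x := g), hl, ← mul_mk, hly]
        exact inv_mul_cancel_right (mk L) (of y)
      rw [hgy, toWord_mk, hL.reduce_eq] at h
      rw [hl, List.head?_append, h] at hg
      simp at hg
    · have hred : (g * of y).toWord = g.toWord ++ [(y, true)] := by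
        rw [toWord_mul, toWord_of]
        refine IsReduced.reduce_eq (List.isChain_append.2 ⟨isReduced_toWord, by simp, ?_⟩)
        intro a ha b hb hab
        rw [hl] at ha
        simp only [List.getLast?_append, List.getLast?_singleton, Option.some_or,
          Option.mem_def, Option.some.injEq, List.head?_cons] at ha hb
        subst ha hb
        by_contra h2
        exact hly (Prod.ext hab (by simpa using h2))
      rw [hred, List.head?_append, hg] at h
      simp only [Option.some_or, Option.some.injEq, Prod.mk.injEq] at h
      exact hxy h.1

end FreeGroup

namespace BraidInf

open FreeGroup

/-! ### The action on the free group and the irreflexivity of the braid order -/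

/-- The endomorphism `x_i ↦ x_{i+1}`, `x_{i+1} ↦ x_{i+1}⁻¹ x_i x_{i+1}` of the free group. -/
def artinHom (i : ℕ) : FreeGroup ℕ →* FreeGroup ℕ :=
  FreeGroup.lift fun k => if k = i then of (i + 1) else
    if k = i + 1 then (of (i + 1))⁻¹ * of i * of (i + 1) else of k

/-- The inverse `x_{i+1} ↦ x_i`, `x_i ↦ x_i x_{i+1} x_i⁻¹` of `artinHom i`. -/
def artinInv (i : ℕ) : FreeGroup ℕ →* FreeGroup ℕ :=
  FreeGroup.lift fun k => if k = i then of i * of (i + 1) * (of i)⁻¹ else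
    if k = i + 1 then of i else of k

theorem artinHom_self (i : ℕ) : artinHom i (of i) = of (i + 1) := by
  simp [artinHom]

theorem artinHom_succ (i : ℕ) :
    artinHom i (of (i + 1)) = (of (i + 1))⁻¹ * of i * of (i + 1) := by
  simp [artinHom]

theorem artinHom_of_ne {i k : ℕ} (h : k ≠ i) (h' : k ≠ i + 1) : artinHom i (of k) = of k := by
  simp [artinHom, h, h']

theorem artinInv_self (i : ℕ) : artinInv i (of i) = of i * of (i + 1) * (of i)⁻¹ := by
  simp [artinInv]

theorem artinInv_succ (i : ℕ) : artinInv i (of (i + 1)) = of i := by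
  simp [artinInv]

theorem artinInv_of_ne {i k : ℕ} (h : k ≠ i) (h' : k ≠ i + 1) : artinInv i (of k) = of k := by
  simp [artinInv, h, h']

/-- The Artin automorphism of the free group attached to `σ_i`. -/
def artinAut (i : ℕ) : MulAut (FreeGroup ℕ) :=
  MonoidHom.toMulEquiv (artinHom i) (artinInv i)
    (by
      ext k
      rw [MonoidHom.comp_apply, MonoidHom.id_apply]
      by_cases h : k = i
      · rw [h, artinHom_self, artinInv_succ]
      by_cases h' : k = i + 1
      · rw [h', artinHom_succ]
        simp only [_root_.map_mul, _root_.map_inv, artinInv_succ, artinInv_self]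
        group
      rw [artinHom_of_ne h h', artinInv_of_ne h h'])
    (by
      ext k
      rw [MonoidHom.comp_apply, MonoidHom.id_apply]
      by_cases h : k = i
      · rw [h, artinInv_self]
        simp only [_root_.map_mul, _root_.map_inv, artinHom_succ, artinHom_self]
        group
      by_cases h' : k = i + 1
      · rw [h', artinInv_succ, artinHom_self]
      rw [artinInv_of_ne h h', artinHom_of_ne h h'])

theorem artinAut_apply (i : ℕ) (g : FreeGroup ℕ) : artinAut i g = artinHom i g := rfl

theorem mulAut_ext {f g : MulAut (FreeGroup ℕ)} (h : ∀ k, f (of k) = g (of k)) : f = g := by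
  apply MulEquiv.toMonoidHom_injective
  ext k
  exact h k

theorem artinAut_comm {i j : ℕ} (h : i + 2 ≤ j) :
    artinAut i * artinAut j = artinAut j * artinAut i := by
  refine mulAut_ext fun k => ?_
  simp only [MulAut.mul_apply, artinAut_apply]
  by_cases h1 : k = i
  · rw [h1, artinHom_of_ne (i := j) (by omega) (by omega), artinHom_self,
      artinHom_of_ne (by omega) (by omega)]
  by_cases h2 : k = i + 1
  · rw [h2, artinHom_of_ne (i := j) (by omega) (by omega), artinHom_succ, _root_.map_mul, _root_.map_mul,
      _root_.map_inv, artinHom_of_ne (i := j) (by omega) (by omega),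
      artinHom_of_ne (i := j) (by omega) (by omega)]
  rw [artinHom_of_ne h1 h2]
  by_cases h3 : k = j
  · rw [h3, artinHom_self, artinHom_of_ne (by omega) (by omega)]
  by_cases h4 : k = j + 1
  · rw [h4, artinHom_succ, _root_.map_mul, _root_.map_mul, _root_.map_inv,
      artinHom_of_ne (i := i) (by omega) (by omega),
      artinHom_of_ne (i := i) (by omega) (by omega)]
  rw [artinHom_of_ne h3 h4, artinHom_of_ne h1 h2]

theorem artinAut_braid (i : ℕ) :
    artinAut i * artinAut (i + 1) * artinAut i =
      artinAut (i + 1) * artinAut i * artinAut (i + 1) := by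
  refine mulAut_ext fun k => ?_
  simp only [MulAut.mul_apply, artinAut_apply]
  have e1 : artinHom i (of (i + 1 + 1)) = of (i + 1 + 1) := artinHom_of_ne (by omega) (by omega)
  have e2 : artinHom (i + 1) (of i) = of i := artinHom_of_ne (by omega) (by omega)
  by_cases h1 : k = i
  · rw [h1, artinHom_self, artinHom_self, e1, e2, artinHom_self, artinHom_self]
  by_cases h2 : k = i + 1
  · rw [h2, artinHom_succ, artinHom_self, e1]
    simp only [_root_.map_mul, _root_.map_inv, e1, e2, artinHom_self, artinHom_succ]
  by_cases h3 : k = i + 1 + 1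
  · rw [h3, e1, artinHom_succ]
    simp only [_root_.map_mul, _root_.map_inv, e1, e2, artinHom_self, artinHom_succ]
    group
  rw [artinHom_of_ne h1 h2, artinHom_of_ne h2 h3, artinHom_of_ne h1 h2, artinHom_of_ne h2 h3]

/-- Artin's action of `B_∞` on the free group. -/
def artinAction : BraidInf →* MulAut (FreeGroup ℕ) :=
  PresentedGroup.toGroup (f := fun i : Set.Ici 1 => artinAut i) (by
    rintro r (⟨⟨i, hi⟩, ⟨j, hj⟩, h, rfl⟩ | ⟨⟨i, hi⟩, ⟨j, hj⟩, h, rfl⟩)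
    · simp only [_root_.map_mul, _root_.map_inv, FreeGroup.lift_apply_of]
      rw [mul_inv_eq_one]
      simp only at h
      rcases le_abs.1 h with h | h
      · exact (artinAut_comm (by omega)).symm
      · exact artinAut_comm (by omega)
    · simp only [_root_.map_mul, _root_.map_inv, FreeGroup.lift_apply_of]
      rw [mul_inv_eq_one]
      simp only at h
      rcases (abs_eq zero_le_one).1 h with h | h
      · obtain rfl : i = j + 1 := by omega
        exact (artinAut_braid j).symm
      · obtain rfl : j = i + 1 := by omega
        exact artinAut_braid i)

/-- The braid represented by a braid word. -/
def ofWord (w : List (Set.Ici 1 × Bool)) : BraidInf :=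
  PresentedGroup.mk (artinRels (Set.Ici 1)) (FreeGroup.mk w)

theorem ofWord_append (w w' : List (Set.Ici 1 × Bool)) :
    ofWord (w ++ w') = ofWord w * ofWord w' := by
  rw [ofWord, ← FreeGroup.mul_mk, _root_.map_mul]
  rfl

theorem artinAction_true (i : Set.Ici 1) (g : FreeGroup ℕ) :
    artinAction (ofWord [(i, true)]) g = artinHom i g := by
  have h : artinAction (PresentedGroup.of i) = artinAut i := PresentedGroup.toGroup.of _
  exact DFunLike.congr_fun h g

theorem artinAction_false (i : Set.Ici 1) (g : FreeGroup ℕ) :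
    artinAction (ofWord [(i, false)]) g = artinInv i g := by
  have h : artinAction (PresentedGroup.of i) = artinAut i := PresentedGroup.toGroup.of _
  have h' : artinAction (PresentedGroup.of i)⁻¹ = (artinAut i)⁻¹ := by rw [_root_.map_inv, h]
  exact DFunLike.congr_fun h' g

theorem artinHom_mem_avoiding {i j : ℕ} (h : j < i) {z : ℕ} (hz : z ≠ i + 1) :
    artinHom j (of z) ∈ avoiding (i + 1) := by
  have h1 : of (j + 1) ∈ avoiding (i + 1) := of_mem_avoiding (by omega)
  by_cases hj : z = j
  · rw [hj, artinHom_self]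
    exact h1
  by_cases hj' : z = j + 1
  · rw [hj', artinHom_succ]
    exact mul_mem (mul_mem (inv_mem h1) (of_mem_avoiding (by omega))) h1
  rw [artinHom_of_ne hj hj']
  exact of_mem_avoiding hz

theorem artinInv_mem_avoiding {i j : ℕ} (h : j < i) {z : ℕ} (hz : z ≠ i + 1) :
    artinInv j (of z) ∈ avoiding (i + 1) := by
  have h1 : of j ∈ avoiding (i + 1) := of_mem_avoiding (by omega)
  by_cases hj : z = j
  · rw [hj, artinInv_self]
    exact mul_mem (mul_mem h1 (of_mem_avoiding (by omega))) (inv_mem h1)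
  by_cases hj' : z = j + 1
  · rw [hj', artinInv_succ]
    exact h1
  rw [artinInv_of_ne hj hj']
  exact of_mem_avoiding hz

/-- The key step of Larue's argument: `σ_i` preserves the set of the elements that start with
`x_{i+1}⁻¹`. Followed by the conjugation by `x_{i+1}`, it exchanges `x_i` with `x_{i+1}` and maps
every other `x_k` to `x_{i+1} x_k x_{i+1}⁻¹`, so that `map_mem_startsWith` applies. -/
theorem artinHom_mem_startsWith (i : ℕ) {g : FreeGroup ℕ}
    (hg : g ∈ startsWith (i + 1, false)) : artinHom i g ∈ startsWith (i + 1, false) := by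
  let θ : FreeGroup ℕ →* FreeGroup ℕ :=
    (MulAut.conj (of (i + 1))).toMonoidHom.comp (artinAut i).toMonoidHom
  have hθ (h : FreeGroup ℕ) : θ h = of (i + 1) * artinHom i h * (of (i + 1))⁻¹ := rfl
  have h := map_mem_startsWith (x := i) (y := i + 1) (θ := θ)
    ((MulAut.conj (of (i + 1))).injective.comp (artinAut i).injective)
    (by rw [hθ, artinHom_succ]; group)
    (by
      intro z hz
      have h1 : of (i + 1) ∈ avoiding i := of_mem_avoiding (by omega)
      rw [hθ]
      refine mul_mem (mul_mem h1 ?_) (inv_mem h1)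
      by_cases hi : z = i
      · rw [hi, artinHom_self]
        exact h1
      · rw [artinHom_of_ne hi hz]
        exact of_mem_avoiding hi)
    hg
  have h2 := inv_of_mul_mul_of_mem_startsWith (y := i + 1) (by omega) h
  rw [hθ] at h2
  convert h2 using 1
  group

theorem artinAction_letter_mem {i : ℕ} {l : Set.Ici 1 × Bool} (hl : (l.1 : ℕ) ≤ i)
    (hneg : l.2 = false → (l.1 : ℕ) ≠ i) {g : FreeGroup ℕ} (hg : g ∈ startsWith (i + 1, false)) :
    artinAction (ofWord [l]) g ∈ startsWith (i + 1, false) := by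
  obtain ⟨j, e⟩ := l
  rcases hl.lt_or_eq with h | h
  · simp only at h
    cases e
    · rw [artinAction_false]
      exact map_mem_startsWith (θ := artinInv j) ((artinAut j)⁻¹).injective
        (artinInv_of_ne (by omega) (by omega)) (fun z hz => artinInv_mem_avoiding h hz) hg
    · rw [artinAction_true]
      exact map_mem_startsWith (θ := artinHom j) (artinAut j).injective
        (artinHom_of_ne (by omega) (by omega)) (fun z hz => artinHom_mem_avoiding h hz) hg
  · cases e
    · exact absurd h (hneg rfl)
    · simp only at h
      rw [artinAction_true, h]
      exact artinHom_mem_startsWith i hg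

theorem artinAction_word {i : ℕ} {w : List (Set.Ici 1 × Bool)} (hw : ∀ l ∈ w, (l.1 : ℕ) ≤ i)
    (hneg : ∀ l ∈ w, l.2 = false → (l.1 : ℕ) ≠ i) :
    ((∃ l ∈ w, (l.1 : ℕ) = i) ∧ artinAction (ofWord w) (of (i + 1)) ∈ startsWith (i + 1, false)) ∨
      ((∀ l ∈ w, (l.1 : ℕ) ≠ i) ∧ artinAction (ofWord w) (of (i + 1)) = of (i + 1)) := by
  induction w with
  | nil =>
    right
    refine ⟨by simp, ?_⟩
    have : ofWord [] = 1 := _root_.map_one _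
    rw [this, _root_.map_one, MulAut.one_apply]
  | cons l w ih =>
    have hlw : ofWord (l :: w) = ofWord [l] * ofWord w := ofWord_append [l] w
    have hl := hw l List.mem_cons_self
    have hln := hneg l List.mem_cons_self
    rw [hlw, _root_.map_mul, MulAut.mul_apply]
    rcases ih (fun l' h => hw l' (List.mem_cons_of_mem _ h))
      (fun l' h => hneg l' (List.mem_cons_of_mem _ h)) with ⟨⟨l', h1, h2⟩, h3⟩ | ⟨h1, h2⟩
    · exact Or.inl ⟨⟨l', List.mem_cons_of_mem _ h1, h2⟩, artinAction_letter_mem hl hln h3⟩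
    · rw [h2]
      obtain ⟨j, e⟩ := l
      simp only at hl hln
      rcases hl.lt_or_eq with h | h
      · right
        refine ⟨?_, ?_⟩
        · intro l' hl'
          rcases List.mem_cons.1 hl' with rfl | hl'
          · exact h.ne
          · exact h1 l' hl'
        · cases e
          · rw [artinAction_false, artinInv_of_ne (by omega) (by omega)]
          · rw [artinAction_true, artinHom_of_ne (by omega) (by omega)]
      · left
        refine ⟨⟨(j, e), List.mem_cons_self, h⟩, ?_⟩
        cases e
        · exact absurd h (hln rfl)
        · rw [artinAction_true, h, artinHom_succ]
          simp only [startsWith, Set.mem_ofPred_eq]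
          have : ((of (i + 1))⁻¹ * of i * of (i + 1)).toWord =
              [(i + 1, false), (i, true), (i + 1, true)] := by
            change (FreeGroup.mk [(i + 1, false), (i, true), (i + 1, true)]).toWord = _
            rw [toWord_mk]
            refine IsReduced.reduce_eq ?_
            simp [FreeGroup.IsReduced]
          rw [this]
          rfl

theorem ofWord_ne_one {w : List (Set.Ici 1 × Bool)} (hw : IsSigmaPositiveWord w) :
    ofWord w ≠ 1 := by
  obtain ⟨i, h1, h2, h3⟩ := hw
  intro h
  rcases artinAction_word (i := (i : ℕ)) (w := w) (fun l hl => h3 l hl) (by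
    rintro ⟨j, e⟩ hl rfl hj
    obtain rfl : j = i := Subtype.ext hj
    exact h2 hl) with ⟨-, h4⟩ | ⟨h4, -⟩
  · rw [h, _root_.map_one, MulAut.one_apply, startsWith, Set.mem_ofPred_eq, toWord_of] at h4
    simp at h4
  · exact h4 _ h1 rfl

theorem IsSigmaPositiveWord.append {w w' : List (Set.Ici 1 × Bool)} (h : IsSigmaPositiveWord w)
    (h' : IsSigmaPositiveWord w') : IsSigmaPositiveWord (w ++ w') := by
  obtain ⟨i, h1, h2, h3⟩ := h
  obtain ⟨j, k1, k2, k3⟩ := h'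
  rcases lt_trichotomy i j with hij | rfl | hij
  · refine ⟨j, List.mem_append_right _ k1, ?_, ?_⟩
    · rw [List.mem_append, not_or]
      exact ⟨fun hm => absurd (h3 _ hm) (not_le.2 hij), k2⟩
    · intro x hx
      rcases List.mem_append.1 hx with hx | hx
      exacts [(h3 x hx).trans hij.le, k3 x hx]
  · refine ⟨i, List.mem_append_left _ h1, ?_, ?_⟩
    · rw [List.mem_append, not_or]
      exact ⟨h2, k2⟩
    · intro x hx
      rcases List.mem_append.1 hx with hx | hx
      exacts [h3 x hx, k3 x hx]
  · refine ⟨i, List.mem_append_left _ h1, ?_, ?_⟩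
    · rw [List.mem_append, not_or]
      exact ⟨h2, fun hm => absurd (k3 _ hm) (not_le.2 hij)⟩
    · intro x hx
      rcases List.mem_append.1 hx with hx | hx
      exacts [h3 x hx, (k3 x hx).trans hij.le]

theorem Lt.irrefl (a : BraidInf) : ¬ BraidInf.Lt a a := by
  rintro ⟨w, hw, h⟩
  rw [inv_mul_cancel] at h
  exact ofWord_ne_one hw h

theorem Lt.trans {a b c : BraidInf} (h : BraidInf.Lt a b) (h' : BraidInf.Lt b c) :
    BraidInf.Lt a c := by
  obtain ⟨w, hw, h⟩ := h
  obtain ⟨w', hw', h'⟩ := h'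
  refine ⟨w ++ w', IsSigmaPositiveWord.append hw hw', ?_⟩
  have := ofWord_append w w'
  rw [ofWord, ofWord, ofWord, h, h'] at this
  rw [this]
  group

theorem exists_word_of_mem_strands {k : ℕ} {g : BraidInf} (hg : g ∈ strands k) :
    ∃ w, ofWord w = g ∧ ∀ l ∈ w, (l.1 : ℕ) < k := by
  induction hg using Subgroup.closure_induction with
  | mem x hx =>
    obtain ⟨i, hi, rfl⟩ := hx
    by_cases h : 1 ≤ i
    · refine ⟨[(⟨i, h⟩, true)], ?_, by simpa using hi⟩
      rw [s, dif_pos h]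
      rfl
    · exact ⟨[], by rw [s, dif_neg h]; exact _root_.map_one _, by simp⟩
  | one => exact ⟨[], _root_.map_one _, by simp⟩
  | mul x y _ _ hx hy =>
    obtain ⟨w, rfl, hw⟩ := hx
    obtain ⟨w', rfl, hw'⟩ := hy
    refine ⟨w ++ w', ofWord_append w w', fun l hl => ?_⟩
    rcases List.mem_append.1 hl with hl | hl
    exacts [hw l hl, hw' l hl]
  | inv x _ hx =>
    obtain ⟨w, rfl, hw⟩ := hx
    refine ⟨FreeGroup.invRev w, ?_, fun l hl => ?_⟩
    · rw [ofWord, ofWord, ← FreeGroup.inv_mk, _root_.map_inv]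
    · rw [FreeGroup.invRev, List.mem_reverse, List.mem_map] at hl
      obtain ⟨l', hl', rfl⟩ := hl
      exact hw l' hl'

theorem exists_word_of_mem_nonneg {k : ℕ} {g : BraidInf} (hg : g ∈ nonneg k) :
    ∃ w, ofWord w = g ∧ ∀ l ∈ w, (l.1 : ℕ) ≤ k ∧ (l.2 = false → (l.1 : ℕ) ≠ k) := by
  induction hg using Submonoid.closure_induction with
  | mem x hx =>
    rcases hx with rfl | hx
    · by_cases h : 1 ≤ k
      · refine ⟨[(⟨k, h⟩, true)], ?_, by simp⟩
        rw [s, dif_pos h]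
        rfl
      · exact ⟨[], by rw [s, dif_neg h]; exact _root_.map_one _, by simp⟩
    · obtain ⟨w, rfl, hw⟩ := exists_word_of_mem_strands hx
      exact ⟨w, rfl, fun l hl => ⟨(hw l hl).le, fun _ => (hw l hl).ne⟩⟩
  | one => exact ⟨[], _root_.map_one _, by simp⟩
  | mul x y _ _ hx hy =>
    obtain ⟨w, rfl, hw⟩ := hx
    obtain ⟨w', rfl, hw'⟩ := hy
    refine ⟨w ++ w', ofWord_append w w', fun l hl => ?_⟩
    rcases List.mem_append.1 hl with hl | hl
    exacts [hw l hl, hw' l hl]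

theorem lt_of_nonneg {k : ℕ} (hk : 1 ≤ k) {a b q r : BraidInf} (hq : q ∈ nonneg k)
    (hr : r ∈ nonneg k) (h : a⁻¹ * b = q * s k * r) : BraidInf.Lt a b := by
  obtain ⟨w, rfl, hw⟩ := exists_word_of_mem_nonneg hq
  obtain ⟨w', rfl, hw'⟩ := exists_word_of_mem_nonneg hr
  have hs : s k = ofWord [(⟨k, hk⟩, true)] := by
    rw [s, dif_pos hk]
    rfl
  rw [hs, ← ofWord_append, ← ofWord_append] at h
  have key : ∀ l ∈ w ++ [(⟨k, hk⟩, true)] ++ w',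
      (l.1 : ℕ) ≤ k ∧ (l.2 = false → (l.1 : ℕ) ≠ k) := by
    intro l hl
    rw [List.mem_append, List.mem_append, List.mem_singleton] at hl
    rcases hl with (hl | rfl) | hl
    exacts [hw l hl, ⟨le_rfl, fun h => by simp at h⟩, hw' l hl]
  refine ⟨w ++ [((⟨k, hk⟩ : Set.Ici 1), true)] ++ w', ?_, h.symm⟩
  exact ⟨⟨k, hk⟩, by simp, fun hl => (key _ hl).2 rfl rfl, fun l hl => (key l hl).1⟩

theorem lt_of_mem_G {j : ℕ} {a b : BraidInf} (h : a⁻¹ * b ∈ G j) : BraidInf.Lt a b := by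
  obtain ⟨q, hq, k, hk, h⟩ := h
  exact lt_of_nonneg (by omega) hq (strands_le_nonneg (H_subset_strands j hk)) h

end BraidInf

namespace Braid

open BraidInf

/-! ### Comparison of skew products -/

theorem conj_garside_mem_positive {n : ℕ} {g : BraidInf} (hg : g ∈ BraidInf.positive n) :
    garside n * g * (garside n)⁻¹ ∈ BraidInf.positive n := by
  refine (Submonoid.closure_le
    (S := (BraidInf.positive n).comap (MulAut.conj (garside n)).toMonoidHom)).2 ?_ hg
  rintro _ ⟨i, hi, rfl⟩
  change garside n * s i * (garside n)⁻¹ ∈ BraidInf.positive n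
  rcases Nat.eq_zero_or_pos i with rfl | h
  · rw [s_zero, mul_one, mul_inv_cancel]
    exact one_mem _
  · rw [garside_mul_s h hi, mul_inv_cancel_right]
    exact s_mem_positive (by omega)

theorem toInf_sepFlip_mem_positive {j : ℕ} {b : Braid (j + 2)}
    (hb : toInf (j + 2) b ∈ BraidInf.positive (j + 2)) :
    toInf (j + 3) (sepFlip (j + 3) b) ∈ BraidInf.positive (j + 3) := by
  rw [toInf_sepFlip]
  exact mul_mem (mul_mem (sepLeft_mem (j + 1))
    (conj_garside_mem_positive (positive_mono (by omega) hb))) (sepRight_mem (j + 1))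

theorem toInf_sepFlip_mem_G {j : ℕ} {b : Braid (j + 2)}
    (hb : toInf (j + 2) b ∈ BraidInf.positive (j + 2)) :
    toInf (j + 3) (sepFlip (j + 3) b) ∈ G j := by
  rw [toInf_sepFlip]
  exact nonneg_mul_mem_G (positive_le_nonneg (mul_mem (sepLeft_mem (j + 1))
    (conj_garside_mem_positive (positive_mono (by omega) hb)))) (sepRight_mem_G j)

theorem toInf_skew_mem_positive {j : ℕ} {l : List (Braid (j + 2))}
    (hl : ∀ b ∈ l, toInf (j + 2) b ∈ BraidInf.positive (j + 2)) :
    toInf (j + 3) (skew (j + 3) l) ∈ BraidInf.positive (j + 3) := by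
  induction l with
  | nil =>
    rw [skew, map_one]
    exact one_mem _
  | cons b l ih =>
    have hb := hl b List.mem_cons_self
    rw [skew, map_mul]
    refine mul_mem ?_ (ih fun b' hb' => hl b' (List.mem_cons_of_mem _ hb'))
    split_ifs
    · exact toInf_sepFlip_mem_positive hb
    · rw [toInf_incl]
      exact positive_mono (by omega) hb

/-- The product `b_p W⁻¹ b_{p-1} W⁻¹ ⋯ W⁻¹ b_1` of the entries of a list, with the value `W` on
the empty list, so that `W⁻¹` times the value on a list of even length is the product with a
separator in front. -/
def sepProd (j : ℕ) : List (Braid (j + 2)) → BraidInf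
  | [] => W (j + 1)
  | b :: l => toInf (j + 2) b * (W (j + 1))⁻¹ * sepProd j l

/-- A skew product of `p` entries is, up to a power of the central element `Δ²` of `B_{j+3}`, the
product of its entries separated by `W⁻¹`. -/
theorem toInf_skew (j : ℕ) (l : List (Braid (j + 2))) :
    toInf (j + 3) (skew (j + 3) l) = (garside (j + 3) ^ 2) ^ (l.length / 2) *
      ((if Even l.length then (W (j + 1))⁻¹ else 1) * sepProd j l) := by
  induction l with
  | nil => simp [skew, sepProd]
  | cons b l ih =>
    have hb : toInf (j + 2) b ∈ strands (j + 3) :=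
      strands_mono (by omega) (toInf_mem_strands b)
    have hW : (W (j + 1))⁻¹ ∈ strands (j + 3) := inv_mem (W_mem (j + 1))
    rw [skew, map_mul, ih, List.length_cons, sepProd]
    by_cases h : Even l.length
    · have h' : ¬ Even (l.length + 1) := Nat.not_even_iff_odd.2 h.add_one
      have hc := ((garside_sq_commute hb).pow_left (l.length / 2)).eq
      rw [if_neg h', if_pos h, if_neg h', toInf_incl,
        show (l.length + 1) / 2 = l.length / 2 by obtain ⟨m, hm⟩ := h; omega, one_mul,
        ← mul_assoc]
      change toInf (j + 2) b * _ * _ = _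
      rw [← hc]
      simp only [mul_assoc]
    · have h' : Even (l.length + 1) := (Nat.not_even_iff_odd.1 h).add_one
      have hc := ((garside_sq_commute (mul_mem (mul_mem hW hb) hW)).pow_left (l.length / 2)).eq
      rw [if_pos h', if_neg h, if_pos h', toInf_sepFlip_eq,
        show (l.length + 1) / 2 = l.length / 2 + 1 by
          obtain ⟨m, hm⟩ := Nat.not_even_iff_odd.1 h; omega, pow_succ' (garside (j + 3) ^ 2), one_mul]
      calc _ = garside (j + 3) ^ 2 * ((W (j + 1))⁻¹ * toInf (j + 2) b * (W (j + 1))⁻¹ *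
            (garside (j + 3) ^ 2) ^ (l.length / 2)) * sepProd j l := by simp only [mul_assoc]
        _ = _ := by rw [← hc]; simp only [mul_assoc]

theorem inv_sepProd_mem_nonneg {j : ℕ} {l : List (Braid (j + 2))} (hl : l ≠ []) :
    (sepProd j l)⁻¹ ∈ nonneg (j + 2) := by
  induction l with
  | nil => exact absurd rfl hl
  | cons b l ih =>
    have hb : (toInf (j + 2) b)⁻¹ ∈ nonneg (j + 2) :=
      strands_le_nonneg (inv_mem (toInf_mem_strands b))
    rcases eq_or_ne l [] with rfl | h
    · rwa [sepProd, sepProd, inv_mul_cancel_right]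
    · rw [sepProd, mul_inv_rev, mul_inv_rev, inv_inv]
      exact mul_mem (ih h) (mul_mem (W_succ_mem_nonneg j) hb)

theorem sepProd_mem_R {j : ℕ} {l : List (Braid (j + 2))} (hl : l ≠ [])
    (hpos : ∀ b ∈ l, toInf (j + 2) b ∈ BraidInf.positive (j + 2)) : sepProd j l ∈ R j := by
  induction l with
  | nil => exact absurd rfl hl
  | cons b l ih =>
    have hb := positive_le_R (hpos b List.mem_cons_self)
    rcases eq_or_ne l [] with rfl | h
    · rwa [sepProd, sepProd, inv_mul_cancel_right]
    · exact mul_mem (mul_mem hb (inv_W_mem_R j))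
        (ih h fun b' hb' => hpos b' (List.mem_cons_of_mem _ hb'))

/-- The relation on `B_{j+2}` by which the braid order is propagated to `B_{j+3}`: `x < y`, and
the conjugate of `x⁻¹ y` by the separator of `B_{j+3}` lies in the absorbing set `G j`. -/
def StrongLt (j : ℕ) (x y : Braid (j + 2)) : Prop :=
  Braid.Lt x y ∧ W (j + 1) * ((toInf (j + 2) x)⁻¹ * toInf (j + 2) y) * (W (j + 1))⁻¹ ∈ G j

/-- The quotients `x⁻¹ y` arising from skew products `x < y` of `B_{j+3}`: they lie in `G j`,
unless `x` and `y` differ in the last entry only, where a missing entry counts as `1`. -/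
def IsGap (j : ℕ) (g : BraidInf) : Prop :=
  g ∈ G j ∨ ∃ a a' : Braid (j + 2), StrongLt j a a' ∧ g = (toInf (j + 2) a)⁻¹ * toInf (j + 2) a'

theorem IsGap.conj_mem_G {j : ℕ} {g : BraidInf} (hg : IsGap j g) :
    W (j + 1) * g * (W (j + 1))⁻¹ ∈ G j := by
  rcases hg with h | ⟨a, a', h, rfl⟩
  · exact conj_W_mem_G h
  · exact h.2

theorem IsGap.strongLt {j : ℕ} {x y : Braid (j + 3)}
    (h : IsGap j ((toInf (j + 3) x)⁻¹ * toInf (j + 3) y)) : StrongLt (j + 1) x y := by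
  refine ⟨?_, conj_W_succ h.conj_mem_G⟩
  rcases h with h | ⟨a, a', ⟨⟨w, hw, h⟩, -⟩, h'⟩
  · exact lt_of_mem_G h
  · exact ⟨w, hw, h.trans h'.symm⟩

theorem sandwich_mem_G {j : ℕ} {g : BraidInf} (hg : g ∈ G j) {l l' : List (Braid (j + 2))}
    (hl : l ≠ []) (hl' : l' ≠ [])
    (hpos : ∀ b ∈ l', toInf (j + 2) b ∈ BraidInf.positive (j + 2)) :
    (sepProd j l)⁻¹ * g * sepProd j l' ∈ G j :=
  sepProd_mem_R hl' hpos _ (nonneg_mul_mem_G (inv_sepProd_mem_nonneg hl) hg)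

theorem IsGap.sandwich {j : ℕ} {g : BraidInf} (hg : IsGap j g) {l l' : List (Braid (j + 2))}
    (hlen : l.length = l'.length)
    (hpos : ∀ b ∈ l', toInf (j + 2) b ∈ BraidInf.positive (j + 2)) :
    IsGap j ((sepProd j l)⁻¹ * (W (j + 1) * g * (W (j + 1))⁻¹) * sepProd j l') := by
  rcases eq_or_ne l [] with rfl | h
  · obtain rfl : l' = [] := List.eq_nil_of_length_eq_zero hlen.symm
    convert hg using 1
    rw [sepProd]
    group
  · have h' : l' ≠ [] := by
      rintro rfl
      exact h (List.eq_nil_of_length_eq_zero hlen)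
    exact Or.inl (sandwich_mem_G hg.conj_mem_G h h' hpos)

theorem isGap_sepProd_of_lex {j : ℕ} {l l' : List (Braid (j + 2))} (hlen : l.length = l'.length)
    (hpos : ∀ b ∈ l', toInf (j + 2) b ∈ BraidInf.positive (j + 2))
    (h : List.Lex (StrongLt j) l l') : IsGap j ((sepProd j l)⁻¹ * sepProd j l') := by
  induction h with
  | nil => simp at hlen
  | @cons a l l' _ ih =>
    have h1 := ih (by simpa using hlen) fun b hb => hpos b (List.mem_cons_of_mem _ hb)
    convert h1 using 1
    rw [sepProd, sepProd]
    group
  | @rel a l a' l' haa =>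
    have h1 := IsGap.sandwich (Or.inr ⟨a, a', haa, rfl⟩) (l := l) (l' := l')
      (by simpa using hlen) fun b hb => hpos b (List.mem_cons_of_mem _ hb)
    convert h1 using 1
    rw [sepProd, sepProd]
    group

/-- The left factor by which a skew product exceeds the skew product of its last entries is in
`G j`, unless it is a single unflipped entry. -/
theorem exists_skew_append (j : ℕ) (l₁ l₂ : List (Braid (j + 2))) (h₁ : l₁ ≠ [])
    (hpos : ∀ b ∈ l₁, toInf (j + 2) b ∈ BraidInf.positive (j + 2)) :
    ∃ X : BraidInf, toInf (j + 3) (skew (j + 3) (l₁ ++ l₂)) =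
        X * toInf (j + 3) (skew (j + 3) l₂) ∧ X ∈ strands (j + 3) ∧
      (X ∈ G j ∨ (Even l₂.length ∧ ∃ b, l₁ = [b] ∧ X = toInf (j + 2) b)) := by
  induction l₁ with
  | nil => exact absurd rfl h₁
  | cons b l ih =>
    have hb := hpos b List.mem_cons_self
    have hflip := toInf_sepFlip_mem_G hb
    rw [List.cons_append, skew, map_mul]
    have hmem := toInf_mem_strands
      (if Even ((l ++ l₂).length + 1) then sepFlip (j + 3) b else incl (j + 3) b)
    rcases eq_or_ne l [] with rfl | hl
    · refine ⟨_, rfl, hmem, ?_⟩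
      rw [List.nil_append]
      split_ifs with h
      · exact Or.inl hflip
      · right
        rw [toInf_incl]
        exact ⟨by simpa [Nat.even_add_one] using h, b, rfl, rfl⟩
    · obtain ⟨X, hX, hXmem, hX'⟩ := ih hl fun b' hb' => hpos b' (List.mem_cons_of_mem _ hb')
      refine ⟨_, by rw [hX, ← mul_assoc], mul_mem hmem hXmem, Or.inl ?_⟩
      rcases hX' with hG | ⟨heven, c, rfl, rfl⟩
      · refine nonneg_mul_mem_G ?_ hG
        split_ifs
        · exact G_subset_nonneg hflip
        · rw [toInf_incl]
          exact strands_le_nonneg (toInf_mem_strands b)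
      · -- The entry left of an unflipped one is flipped.
        have h : Even (([c] ++ l₂).length + 1) := by
          rw [List.length_append, List.length_singleton, add_right_comm]
          exact Even.add even_two heven
        rw [if_pos h]
        exact positive_le_R (hpos c (by simp)) _ hflip

theorem strongLt_skew {j : ℕ} {l l' : List (Braid (j + 2))}
    (hpos : ∀ b ∈ l', toInf (j + 2) b ∈ BraidInf.positive (j + 2))
    (hhead : ∀ b ∈ l'.head?, StrongLt j 1 b) (h : List.Shortlex (StrongLt j) l l') :
    StrongLt (j + 1) (skew (j + 3) l) (skew (j + 3) l') := by
  apply IsGap.strongLt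
  rcases List.shortlex_def.1 h with hlen | ⟨hlen, hlex⟩
  · obtain ⟨l₁, l₂, rfl, h₂⟩ : ∃ l₁ l₂, l' = l₁ ++ l₂ ∧ l₂.length = l.length :=
      ⟨l'.take (l'.length - l.length), l'.drop (l'.length - l.length),
        (List.take_append_drop _ _).symm, by rw [List.length_drop]; omega⟩
    have h₁ : l₁ ≠ [] := by
      rintro rfl
      rw [List.nil_append] at hlen
      omega
    have hpos₂ : ∀ b ∈ l₂, toInf (j + 2) b ∈ BraidInf.positive (j + 2) :=
      fun b hb => hpos b (List.mem_append_right _ hb)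
    obtain ⟨X, hX, hXmem, hX'⟩ := exists_skew_append j l₁ l₂ h₁
      fun b hb => hpos b (List.mem_append_left _ hb)
    have hc : X * (garside (j + 3) ^ 2) ^ (l.length / 2) =
        (garside (j + 3) ^ 2) ^ (l.length / 2) * X :=
      (((garside_sq_commute hXmem).pow_left (l.length / 2)).eq).symm
    rw [hX, toInf_skew, toInf_skew, h₂, ← mul_assoc X, hc]
    generalize (garside (j + 3) ^ 2) ^ (l.length / 2) = Z
    by_cases heven : Even l.length
    · rw [if_pos heven]
      have hgap : IsGap j X := by
        rcases hX' with hG | ⟨-, b, rfl, rfl⟩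
        · exact Or.inl hG
        · exact Or.inr ⟨1, b, hhead b (by simp), by rw [map_one, inv_one, one_mul]⟩
      convert hgap.sandwich h₂.symm hpos₂ using 1
      group
    · rw [if_neg heven]
      rcases hX' with hG | ⟨he, -⟩
      · have hl : l ≠ [] := by
          rintro rfl
          exact heven (by simp)
        have hl₂ : l₂ ≠ [] := by
          rintro rfl
          exact hl (List.eq_nil_of_length_eq_zero h₂.symm)
        refine Or.inl ?_
        convert sandwich_mem_G hG hl hl₂ hpos₂ using 1
        group
      · exact absurd (h₂ ▸ he) heven
  · rw [toInf_skew, toInf_skew, hlen]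
    convert isGap_sepProd_of_lex hlen hpos hlex using 1
    group

/-! ### Special braids -/

theorem exists_skew_of_isSpecial {j : ℕ} {x : Braid (j + 3)} (hx : IsSpecial (j + 3) x) :
    ∃ l : List (Braid (j + 2)), (∀ b ∈ l, IsSpecial (j + 2) b) ∧ (∀ b ∈ l.head?, b ≠ 1) ∧
      x = skew (j + 3) l := by
  rw [IsSpecial] at hx
  rcases hx with rfl | ⟨c, l, hc, hsc, hl, rfl⟩
  · exact ⟨[], by simp, by simp, rfl⟩
  · refine ⟨c :: l, ?_, ?_, rfl⟩
    · intro b hb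
      rcases List.mem_cons.1 hb with rfl | hb
      exacts [hsc, hl b hb]
    · intro b hb
      rw [List.head?_cons, Option.mem_some_iff] at hb
      exact hb ▸ hc

theorem IsSpecial.toInf_mem_positive {j : ℕ} {x : Braid (j + 2)} (hx : IsSpecial (j + 2) x) :
    toInf (j + 2) x ∈ BraidInf.positive (j + 2) := by
  induction j with
  | zero =>
    rw [IsSpecial] at hx
    exact toInf_positive hx
  | succ j ih =>
    obtain ⟨l, hl, -, rfl⟩ := exists_skew_of_isSpecial hx
    exact toInf_skew_mem_positive fun b hb => ih (hl b hb)

theorem exists_pow_of_mem_positive_two {x : Braid 2} (hx : x ∈ Braid.positive 2) :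
    ∃ k : ℕ, x = σ 2 1 ^ k := by
  induction hx using Submonoid.closure_induction with
  | mem x hx =>
    obtain ⟨⟨i, h1, h2⟩, rfl⟩ := hx
    obtain rfl : i = 1 := by omega
    exact ⟨1, by rw [pow_one]; rfl⟩
  | one => exact ⟨0, (pow_zero _).symm⟩
  | mul x y _ _ hx hy =>
    obtain ⟨k, rfl⟩ := hx
    obtain ⟨m, rfl⟩ := hy
    exact ⟨k + m, (pow_add _ _ _).symm⟩

theorem strongLt_pow (k m : ℕ) : StrongLt 0 (σ 2 1 ^ k) (σ 2 1 ^ (k + m + 1)) := by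
  have h : (toInf 2 (σ 2 1 ^ k))⁻¹ * toInf 2 (σ 2 1 ^ (k + m + 1)) = s 1 ^ (m + 1) := by
    rw [map_pow, map_pow, toInf_σ (by omega), add_assoc, pow_add, inv_mul_cancel_left]
  refine ⟨lt_of_nonneg le_rfl (one_mem _) (pow_mem (s_mem_nonneg 1) m) ?_, ?_⟩
  · rw [h, one_mul, pow_succ']
  · change W 1 * ((toInf 2 (σ 2 1 ^ k))⁻¹ * toInf 2 (σ 2 1 ^ (k + m + 1))) * (W 1)⁻¹ ∈ G 0
    rw [h, W_one, s_two_conj_pow]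
    exact ⟨_, inv_s_one_mul_pow_mem m, s 1 ^ 1, ⟨0, rfl⟩, by rw [pow_one]⟩

end Braid

/-- Trichotomy passes from the entries to the ShortLex relation on lists. -/
theorem List.shortlex_trichotomy_of_mem {α : Type*} {r : α → α → Prop} {P : α → Prop}
    (h : ∀ x y, P x → P y → x = y ∨ r x y ∨ r y x) {l l' : List α} (hl : ∀ x ∈ l, P x)
    (hl' : ∀ x ∈ l', P x) : l = l' ∨ List.Shortlex r l l' ∨ List.Shortlex r l' l := by
  rcases lt_trichotomy l.length l'.length with hlen | hlen | hlen
  · exact Or.inr (Or.inl (List.Shortlex.of_length_lt hlen))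
  · have key : l = l' ∨ List.Lex r l l' ∨ List.Lex r l' l := by
      clear hlen
      induction l generalizing l' with
      | nil =>
        cases l' with
        | nil => exact Or.inl rfl
        | cons y l' => exact Or.inr (Or.inl List.Lex.nil)
      | cons x l ih =>
        cases l' with
        | nil => exact Or.inr (Or.inr List.Lex.nil)
        | cons y l' =>
          rcases h x y (hl x List.mem_cons_self) (hl' y List.mem_cons_self) with rfl | hxy | hxy
          · rcases ih (fun z hz => hl z (List.mem_cons_of_mem _ hz))
              (fun z hz => hl' z (List.mem_cons_of_mem _ hz)) with rfl | h1 | h1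
            exacts [Or.inl rfl, Or.inr (Or.inl (List.Lex.cons h1)),
              Or.inr (Or.inr (List.Lex.cons h1))]
          · exact Or.inr (Or.inl (List.Lex.rel hxy))
          · exact Or.inr (Or.inr (List.Lex.rel hxy))
    rcases key with h1 | h1 | h1
    exacts [Or.inl h1, Or.inr (Or.inl (List.Shortlex.of_lex hlen h1)),
      Or.inr (Or.inr (List.Shortlex.of_lex hlen.symm h1))]
  · exact Or.inr (Or.inr (List.Shortlex.of_length_lt hlen))

namespace Braid

theorem IsSpecial.trichotomy_and_one_lt (j : ℕ) :
    (∀ x y : Braid (j + 2), IsSpecial (j + 2) x → IsSpecial (j + 2) y →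
      x = y ∨ StrongLt j x y ∨ StrongLt j y x) ∧
    ∀ x : Braid (j + 2), IsSpecial (j + 2) x → x ≠ 1 → StrongLt j 1 x := by
  induction j with
  | zero =>
    constructor
    · intro x y hx hy
      obtain ⟨k, rfl⟩ := exists_pow_of_mem_positive_two (x := x) (by rwa [IsSpecial] at hx)
      obtain ⟨m, rfl⟩ := exists_pow_of_mem_positive_two (x := y) (by rwa [IsSpecial] at hy)
      rcases lt_trichotomy k m with h | rfl | h
      · obtain ⟨e, rfl⟩ := Nat.exists_eq_add_of_lt h
        exact Or.inr (Or.inl (strongLt_pow k e))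
      · exact Or.inl rfl
      · obtain ⟨e, rfl⟩ := Nat.exists_eq_add_of_lt h
        exact Or.inr (Or.inr (strongLt_pow m e))
    · intro x hx hx1
      obtain ⟨k, rfl⟩ := exists_pow_of_mem_positive_two (x := x) (by rwa [IsSpecial] at hx)
      rcases k with _ | k
      · exact absurd (pow_zero _) hx1
      · have h := strongLt_pow 0 k
        rwa [Nat.zero_add, pow_zero] at h
  | succ j ih =>
    have key : ∀ l l' : List (Braid (j + 2)), (∀ b ∈ l', IsSpecial (j + 2) b) →
        (∀ b ∈ l'.head?, b ≠ 1) → List.Shortlex (StrongLt j) l l' →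
        StrongLt (j + 1) (skew (j + 3) l) (skew (j + 3) l') := fun l l' hl' hh h =>
      strongLt_skew (fun b hb => (hl' b hb).toInf_mem_positive)
        (fun b hb => ih.2 b (hl' b (List.mem_of_mem_head? hb)) (hh b hb)) h
    constructor
    · intro x y hx hy
      obtain ⟨l, hl, hh, rfl⟩ := exists_skew_of_isSpecial hx
      obtain ⟨l', hl', hh', rfl⟩ := exists_skew_of_isSpecial hy
      rcases List.shortlex_trichotomy_of_mem ih.1 hl hl' with rfl | h | h
      exacts [Or.inl rfl, Or.inr (Or.inl (key l l' hl' hh' h)),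
        Or.inr (Or.inr (key l' l hl hh h))]
    · intro x hx hx1
      obtain ⟨l, hl, hh, rfl⟩ := exists_skew_of_isSpecial hx
      refine key [] l hl hh (List.Shortlex.of_length_lt ?_)
      rw [List.length_nil, List.length_pos_iff]
      rintro rfl
      exact hx1 rfl

end Braid

theorem proposition4p6 (n : ℕ) (hn : 3 ≤ n) (b b' : Braid n)
    (bs bs' : List (Braid (n - 1)))
    (hspecial : ∀ x ∈ bs, Braid.IsSpecial (n - 1) x)
    (hspecial' : ∀ x ∈ bs', Braid.IsSpecial (n - 1) x)
    (hlead : ∀ x ∈ bs.head?, x ≠ 1)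
    (hlead' : ∀ x ∈ bs'.head?, x ≠ 1)
    (hb : b = Braid.skew n bs) (hb' : b' = Braid.skew n bs') :
    Braid.Lt b b' ↔ List.Shortlex Braid.Lt bs bs' := by
  obtain ⟨j, rfl⟩ : ∃ j, n = j + 3 := ⟨n - 3, by omega⟩
  change List (Braid (j + 2)) at bs bs'
  subst hb hb'
  have hspec := Braid.IsSpecial.trichotomy_and_one_lt j
  have key : ∀ l l' : List (Braid (j + 2)), (∀ b ∈ l', Braid.IsSpecial (j + 2) b) →
      (∀ b ∈ l'.head?, b ≠ 1) → List.Shortlex (Braid.StrongLt j) l l' →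
      Braid.Lt (Braid.skew (j + 3) l) (Braid.skew (j + 3) l') := fun l l' hl' hh h =>
    (Braid.strongLt_skew (fun b hb => (hl' b hb).toInf_mem_positive)
      (fun b hb => hspec.2 b (hl' b (List.mem_of_mem_head? hb)) (hh b hb)) h).1
  have weaken : ∀ l l' : List (Braid (j + 2)), List.Shortlex (Braid.StrongLt j) l l' →
      List.Shortlex Braid.Lt l l' := by
    intro l l' h
    rw [List.shortlex_def] at h ⊢
    exact h.imp_right fun h => ⟨h.1, List.Lex.imp (fun _ _ h => h.1) _ _ h.2⟩
  have : Std.Asymm (Braid.Lt : Braid (j + 2) → Braid (j + 2) → Prop) :=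
    ⟨fun _ _ h h' => BraidInf.Lt.irrefl _ (h.trans h')⟩
  have hasymm : ∀ l l' : List (Braid (j + 2)), List.Shortlex Braid.Lt l l' →
      ¬ List.Shortlex Braid.Lt l' l := fun _ _ => Std.Asymm.asymm _ _
  rcases List.shortlex_trichotomy_of_mem hspec.1 hspecial hspecial' with rfl | h | h
  · exact ⟨fun h => absurd h (BraidInf.Lt.irrefl _), fun h => absurd h (hasymm _ _ h)⟩
  · exact ⟨fun _ => weaken _ _ h, fun _ => key _ _ hspecial' hlead' h⟩
  · exact ⟨fun h' => absurd ((key _ _ hspecial hlead h).trans h') (BraidInf.Lt.irrefl _),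
      fun h' => absurd h' (hasymm _ _ (weaken _ _ h))⟩
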